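/- Let $\mathbf D$ be an infinite set of atomic values and $\mathbf X$ a set of variables, whose elements are written as bit strings by fixed injective encodings. Fix a relational schema $\Sigma=(R_1[U_1],\dots,R_k[U_k])$ with finite nonempty attribute sets $U_i$. A (tuple-level) gWSD over $\Sigma$ is a pair $(\{C_1,\dots,C_m\},\phi)$. Here $\phi$ is a conjunction of possibly negated equalities between elements of $\mathbf D\cup\mathbf X$, and $C_1,\dots,C_m$ (the components) are finite non-nullary relations with entries in $\mathbf D\cup\mathbf X\cup\{\bot\}$. Their attribute sets are pairwise disjoint and consist of fields $R_i.d.A$ ($d$ a tuple identifier, $A\in U_i$), and whenever a component contains a field $R_i.d.A$, it contains all the fields $R_i.d.B$ with $B\in U_i$. A choice of one row from every component and of a valuation $\nu:\mathbf X\to\mathbf D$ satisfying $\phi$ defines a possible world: the database over $\Sigma$ in which $R_i$ consists of the tuples $\nu(t_d)$, where $d$ ranges over the tuple identifiers of $R_i$ for which the tuple $t_d$ of the chosen entries in the fields $R_i.d.A$, $A\in U_i$, contains no $\bot$. The set of all these worlds is $rep(\mathcal W)$. Positive relational algebra queries over $\Sigma$ are built from the relations $R_i$ by selection with conditions that are negation-free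 Boolean combinations of equalities $A=B$ and $A=c$ ($A,B$ attributes, $c\in\mathbf D$), projection, product, union and renaming. **Theorem.** (1) For every fixed positive relational algebra query $q$ over $\Sigma$, tuple $q$-possibility is in PTIME for gWSDs: the problem to decide, given a gWSD $\mathcal W$ over $\Sigma$ and a tuple $t$ over $\mathbf D$ with the attributes of the answer of $q$, whether there is a world $\mathcal A\in rep(\mathcal W)$ with $t\in q(\mathcal A)$, is solved by a deterministic Turing machine in time polynomial in the length of the input $(\mathcal W,t)$, written as a word over a finite alphabet (rows of components, conditions and values listed explicitly, numbers in binary). (2) In particular, for every relation $R_i$ of $\Sigma$, tuple possibility is in PTIME for gWSDs: given a gWSD $\mathcal W$ over $\Sigma$ and a tuple $t$ over $\mathbf D$ with attribute set $U_i$, it can be decided in the same sense in polynomial time whether there is a world $\mathcal A\in rep(\mathcal W)$ with $t\in R_i^{\mathcal A}$. -/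

import Mathlib

namespace IncompleteDB

/-! ### Relational schemas, databases, positive relational algebra (named perspective) -/

/-- A relational schema `(R₁[U₁], …, R_k[U_k])`: relation names are the elements of
`Fin numRels`, attribute names are natural numbers, every `U_i` is finite and nonempty. -/
structure RelSchema where
  numRels : ℕ
  attrs : Fin numRels → Finset ℕ
  attrs_nonempty : ∀ i, (attrs i).Nonempty

/-- Tuples with entries in `V` over the attribute set `U`. -/
abbrev Tuple (V : Type) (U : Finset ℕ) : Type := U → V

/-- A database over the schema `S` with values in `D`: one relation per relation schema.
All databases below that are represented by a table or a decomposition are finite by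
construction. -/
abbrev Database (S : RelSchema) (D : Type) : Type :=
  (i : Fin S.numRels) → Set (Tuple D (S.attrs i))

/-- Positive selection conditions: Boolean combinations without negation of equalities
`A = B` and `A = c`. -/
inductive SelCond (D : Type) (U : Finset ℕ) : Type
  | top : SelCond D U
  | eqAttr (A B : U) : SelCond D U
  | eqConst (A : U) (c : D) : SelCond D U
  | and (p q : SelCond D U) : SelCond D U
  | or (p q : SelCond D U) : SelCond D U

def SelCond.Holds {D : Type} {U : Finset ℕ} : SelCond D U → Tuple D U → Prop
  | .top, _ => True
  | .eqAttr A B, t => t A = t B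
  | .eqConst A c, t => t A = c
  | .and p q, t => p.Holds t ∧ q.Holds t
  | .or p q, t => p.Holds t ∨ q.Holds t

/-- Positive relational algebra queries over the schema `S`, indexed by the attribute set of
the answer: selection with a positive condition, projection, product, union and renaming of
attributes (no difference). -/
inductive PosQuery (S : RelSchema) (D : Type) : Finset ℕ → Type
  | rel (i : Fin S.numRels) : PosQuery S D (S.attrs i)
  | select {U : Finset ℕ} (p : SelCond D U) (q : PosQuery S D U) : PosQuery S D U
  | project {U : Finset ℕ} (V : Finset ℕ) (h : V ⊆ U) (q : PosQuery S D U) : PosQuery S D V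
  | product {U V : Finset ℕ} (h : Disjoint U V) (q : PosQuery S D U) (r : PosQuery S D V) :
      PosQuery S D (U ∪ V)
  | union {U : Finset ℕ} (q r : PosQuery S D U) : PosQuery S D U
  | rename {U V : Finset ℕ} (f : U ≃ V) (q : PosQuery S D U) : PosQuery S D V

/-- The answer `q(A)` to the query `q` on the database `A`. -/
def PosQuery.eval {S : RelSchema} {D : Type} (A : Database S D) :
    {U : Finset ℕ} → PosQuery S D U → Set (Tuple D U)
  | _, .rel i => A i
  | _, .select p q => {t | t ∈ q.eval A ∧ p.Holds t}
  | _, .project _ h q => {t | ∃ s ∈ q.eval A, ∀ a, t a = s ⟨a.1, h a.2⟩}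
  | _, .product _ q r =>
      {t | (fun a => t ⟨a.1, Finset.mem_union_left _ a.2⟩) ∈ q.eval A ∧
           (fun a => t ⟨a.1, Finset.mem_union_right _ a.2⟩) ∈ r.eval A}
  | _, .union q r => q.eval A ∪ r.eval A
  | _, .rename f q => {t | (fun a => t (f a)) ∈ q.eval A}

/-! ### Conditions and g-multitables -/

/-- Elements of `D ∪ X`: domain values and variables. -/
inductive Term (D X : Type) : Type
  | const (c : D) : Term D X
  | var (x : X) : Term D X

/-- The extension of a valuation to `D ∪ X` by the identity on domain values. -/
def Term.eval {D X : Type} (ν : X → D) : Term D X → D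
  | .const c => c
  | .var x => ν x

/-- Possibly negated equalities over `D ∪ X`. -/
inductive Literal (D X : Type) : Type
  | eq (a b : Term D X) : Literal D X
  | ne (a b : Term D X) : Literal D X

def Literal.Holds {D X : Type} (ν : X → D) : Literal D X → Prop
  | .eq a b => a.eval ν = b.eval ν
  | .ne a b => a.eval ν ≠ b.eval ν

/-- A g-multitable: tables over `D ∪ X` and a global condition, the conjunction of a list of
possibly negated equalities. -/
structure GMultitable (S : RelSchema) (D X : Type) where
  table : (i : Fin S.numRels) → Set (Tuple (Term D X) (S.attrs i))
  cond : List (Literal D X)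

/-- The database `ν(T)`. -/
def GMultitable.apply {S : RelSchema} {D X : Type} (T : GMultitable S D X) (ν : X → D) :
    Database S D :=
  fun i => {t | ∃ s ∈ T.table i, t = fun a => (s a).eval ν}

/-- The set of possible worlds represented by a g-multitable. -/
def GMultitable.rep {S : RelSchema} {D X : Type} (T : GMultitable S D X) :
    Set (Database S D) :=
  {A | ∃ ν : X → D, (∀ l ∈ T.cond, l.Holds ν) ∧ A = T.apply ν}

/-! ### Tabset tables -/

/-- The attribute `R.d.A` of a tabset table: relation `R`, tuple identifier `d`, and an
attribute `A` of `R`. -/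
structure Field (S : RelSchema) where
  rel : Fin S.numRels
  tid : ℕ
  attr : S.attrs rel

/-- Entries of tabset tables: elements of `D ∪ X`, or `⊥` (which is `none`). -/
abbrev Cell (D X : Type) : Type := Option (Term D X)

/-- A g-tabset table with a single global condition. -/
structure GTST (S : RelSchema) (D X : Type) where
  schema : Set (Field S)
  table : Set (schema → Cell D X)
  cond : List (Literal D X)

/-- The inverse of inlining: the relation `R_i` receives, for each tuple identifier `d`, the
tuple of the fields `R_i.d.A`, unless one of these fields is `⊥`. -/
def inlineInv {S : RelSchema} {D X : Type} {F : Set (Field S)} (w : F → Cell D X)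
    (i : Fin S.numRels) : Set (Tuple (Term D X) (S.attrs i)) :=
  {s | ∃ (d : ℕ) (h : ∀ a : S.attrs i, (⟨i, d, a⟩ : Field S) ∈ F),
    ∀ a, w ⟨⟨i, d, a⟩, h a⟩ = some (s a)}

/-- The set of possible worlds represented by a g-tabset table. -/
def GTST.rep {S : RelSchema} {D X : Type} (T : GTST S D X) : Set (Database S D) :=
  ⋃ w ∈ T.table, (GMultitable.mk (inlineInv w) T.cond).rep

/-! ### World-set decompositions -/

/-- A component: a non-nullary relation, given by its distinct column names and the list of
its rows (the local worlds). -/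
structure Component (S : RelSchema) (D X : Type) where
  width : ℕ
  width_pos : 0 < width
  field : Fin width → Field S
  field_injective : Function.Injective field
  rows : List (Fin width → Cell D X)

def Component.schema {S : RelSchema} {D X : Type} (C : Component S D X) : Set (Field S) :=
  Set.range C.field

/-- Attribute-level gWSDs: components with pairwise disjoint schemas, together with a global
condition. With a field `R.d.A`, all fields `R.d.B` with `B` an attribute of `R` occur in the
union of the component schemas. -/
structure AttrGWSD (S : RelSchema) (D X : Type) where
  comps : List (Component S D X)
  cond : List (Literal D X)
  disjoint : comps.Pairwise fun C C' => Disjoint C.schema C'.schema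
  complete : ∀ (i : Fin S.numRels) (d : ℕ) (a b : S.attrs i),
    (∃ C ∈ comps, (⟨i, d, a⟩ : Field S) ∈ C.schema) →
    ∃ C ∈ comps, (⟨i, d, b⟩ : Field S) ∈ C.schema

/-- The g-tabset table `(C₁ × ⋯ × C_m, φ)` of which the gWSD is a decomposition. -/
def AttrGWSD.toGTST {S : RelSchema} {D X : Type} (W : AttrGWSD S D X) : GTST S D X where
  schema := {f | ∃ C ∈ W.comps, f ∈ C.schema}
  table := {w | ∀ (C : Component S D X) (hC : C ∈ W.comps), ∃ r ∈ C.rows,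
    ∀ j, w ⟨C.field j, C, hC, j, rfl⟩ = r j}
  cond := W.cond

/-- The set of possible worlds represented by a gWSD. -/
def AttrGWSD.rep {S : RelSchema} {D X : Type} (W : AttrGWSD S D X) : Set (Database S D) :=
  W.toGTST.rep

/-- (Tuple-level) gWSDs: the fields `R.d.A` and `R.d.B` of one tuple always lie in the same
component schema. -/
structure GWSD (S : RelSchema) (D X : Type) extends AttrGWSD S D X where
  tupleLevel : ∀ C ∈ comps, ∀ (i : Fin S.numRels) (d : ℕ) (a b : S.attrs i),
    (⟨i, d, a⟩ : Field S) ∈ C.schema → (⟨i, d, b⟩ : Field S) ∈ C.schema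

/-! ### Decision problems -/

/-- Tuple q-possibility: `t ∈ q(A)` for some world `A` represented by `W`. -/
def TupleQPossible {S : RelSchema} {D X : Type} {U : Finset ℕ} (q : PosQuery S D U)
    (W : GWSD S D X) (t : Tuple D U) : Prop :=
  ∃ A ∈ W.rep, t ∈ q.eval A

/-- Tuple possibility: `t ∈ R_i^A` for some world `A` represented by `W`. -/
def TuplePossible {S : RelSchema} {D X : Type} (i : Fin S.numRels)
    (W : GWSD S D X) (t : Tuple D (S.attrs i)) : Prop :=
  ∃ A ∈ W.rep, t ∈ A i

/-! ### Encoding of the input as a word over a finite alphabet -/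

/-- The input alphabet: two bits and the markers that start the parts of the input. -/
inductive Sym : Type
  | bit (b : Bool)
  | const | var | bot
  | rel | tid | attr
  | comp | row
  | cond | eq | ne
  | tuple

def encodeBits (l : List Bool) : List Sym := l.map Sym.bit

/-- Binary representation of natural numbers. -/
def encodeNum (n : ℕ) : List Sym := encodeBits (Computability.encodeNat n)

section Encoding

variable {S : RelSchema} {D X : Type} (encD : D → List Bool) (encX : X → List Bool)

def encodeTerm : Term D X → List Sym
  | .const c => Sym.const :: encodeBits (encD c)
  | .var x => Sym.var :: encodeBits (encX x)

def encodeCell : Cell D X → List Sym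
  | none => [Sym.bot]
  | some a => encodeTerm encD encX a

def encodeLiteral : Literal D X → List Sym
  | .eq a b => Sym.eq :: (encodeTerm encD encX a ++ encodeTerm encD encX b)
  | .ne a b => Sym.ne :: (encodeTerm encD encX a ++ encodeTerm encD encX b)

def encodeField (f : Field S) : List Sym :=
  Sym.rel :: encodeNum f.rel ++ Sym.tid :: encodeNum f.tid ++ Sym.attr :: encodeNum f.attr

/-- The header of the component, then its rows. -/
def encodeComponent (C : Component S D X) : List Sym :=
  Sym.comp :: (List.ofFn fun j => encodeField (C.field j)).flatten ++
    C.rows.flatMap fun r => Sym.row :: (List.ofFn fun j => encodeCell encD encX (r j)).flatten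

def encodeGWSD (W : GWSD S D X) : List Sym :=
  W.comps.flatMap (encodeComponent encD encX) ++
    Sym.cond :: W.cond.flatMap (encodeLiteral encD encX)

/-- The values of the tuple, in increasing order of the attribute names. -/
def encodeTuple {U : Finset ℕ} (t : Tuple D U) : List Sym :=
  Sym.tuple :: (List.ofFn fun j : Fin U.card =>
    Sym.const :: encodeBits (encD (t (U.orderIsoOfFin rfl j)))).flatten

/-- The input word for the pair of a gWSD and a tuple. -/
def encodeInput {U : Finset ℕ} (p : GWSD S D X × Tuple D U) : List Sym :=
  encodeGWSD encD encX p.1 ++ encodeTuple encD p.2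

end Encoding

/-- The decision problem `P`, on inputs of type `α` that are written as words by `e`, is in
PTIME: its characteristic function is computed by a Turing machine in time polynomial in the
length of the input word. -/
def InPTIME {α Γ : Type} (e : α → List Γ) (P : α → Prop) : Prop :=
  ∃ f : α → Bool, (∀ a, f a = true ↔ P a) ∧
    Nonempty (Turing.TM2ComputableInPolyTime e Computability.encodeBool f)

end IncompleteDB

open IncompleteDB

/-!
A symbolic answer to the query is a tuple of terms together with the entries that the chosen rows
must have and the equalities that the valuation must satisfy for the tuple to belong to the answer.
A fixed positive query combines a bounded number of tuples of the input relations, so it has only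
polynomially many symbolic answers. The tuple `t` is possible if and only if some symbolic answer
is realized by a world. Since the components have disjoint schemas, the required entries can be
checked in each component separately. What remains is a conjunction of equalities and negated
equalities over an infinite domain: after the elimination of the equalities by substitution, it is
satisfiable if and only if no negated equality has become trivial.

For the machine model, values are coded by binary trees, written as bit strings on a stack. The
functions computed by structured programs over a few stacks contain what the algorithm needs and
are closed under composition, maps and folds, and a program, viewed as a flowchart, is a machine.
-/

namespace StackMachine

/-! ### Flowcharts over stacks -/

/-- Instructions of flowcharts with labels `Λ` over stacks with alphabets `Γ`: jump, push a fixed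
symbol, or pop and dispatch on the popped symbol (`none` if the stack is empty). -/
inductive Instr {K : Type} (Γ : K → Type) (Λ : Type) : Type
  | jump (l : Λ)
  | push (k : K) (s : Γ k) (l : Λ)
  | pop (k : K) (next : Option (Γ k) → Λ)

/-- Contents of the stacks, the top of a stack being the head of the list. -/
abbrev Store {K : Type} (Γ : K → Type) : Type := ∀ k, List (Γ k)

section Flowchart

variable {K : Type} {Γ : K → Type} {Λ Λ' : Type}

/-- Relabelling of the successors of an instruction. -/
def Instr.map (g : Λ → Λ') : Instr Γ Λ → Instr Γ Λ'
  | .jump l => .jump (g l)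
  | .push k s l => .push k s (g l)
  | .pop k next => .pop k fun o => g (next o)

/-- The label at which execution continues. -/
def Instr.next : Instr Γ Λ → Store Γ → Λ
  | .jump l, _ => l
  | .push _ _ l, _ => l
  | .pop k next, S => next (S k).head?

@[simp]
theorem Instr.next_map (g : Λ → Λ') (i : Instr Γ Λ) (S : Store Γ) :
    (i.map g).next S = g (i.next S) := by
  cases i <;> rfl

variable [DecidableEq K]

/-- The effect of an instruction on the stacks. -/
def Instr.store : Instr Γ Λ → Store Γ → Store Γ
  | .jump _, S => S
  | .push k s _, S => Function.update S k (s :: S k)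
  | .pop k _, S => Function.update S k (S k).tail

@[simp]
theorem Instr.store_map (g : Λ → Λ') (i : Instr Γ Λ) (S : Store Γ) :
    (i.map g).store S = i.store S := by
  cases i <;> rfl

/-- `Exec code l S t l' S'`: from label `l` and store `S`, execution reaches label `l'` and store
`S'` within `t` steps. The label `none` is the exit. -/
inductive Exec (code : Λ → Instr Γ (Option Λ)) :
    Option Λ → Store Γ → ℕ → Option Λ → Store Γ → Prop
  | refl (l : Option Λ) (S : Store Γ) (t : ℕ) : Exec code l S t l S
  | step {l : Λ} {S : Store Γ} {t : ℕ} {l' : Option Λ} {S' : Store Γ} :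
      Exec code ((code l).next S) ((code l).store S) t l' S' → Exec code (some l) S (t + 1) l' S'

theorem Exec.mono {code : Λ → Instr Γ (Option Λ)} {l l' : Option Λ} {S S' : Store Γ} {t u : ℕ}
    (h : Exec code l S t l' S') (htu : t ≤ u) : Exec code l S u l' S' := by
  induction h generalizing u with
  | refl => exact .refl _ _ _
  | step _ ih =>
    obtain ⟨v, rfl⟩ : ∃ v, u = v + 1 := ⟨u - 1, by omega⟩
    exact .step (ih (by omega))

theorem Exec.trans {code : Λ → Instr Γ (Option Λ)} {l l' l'' : Option Λ} {S S' S'' : Store Γ}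
    {t u : ℕ} (h : Exec code l S t l' S') (h' : Exec code l' S' u l'' S'') :
    Exec code l S (t + u) l'' S'' := by
  induction h with
  | refl => exact h'.mono (by omega)
  | step _ ih =>
    rw [add_right_comm]
    exact .step (ih h')

theorem Exec.embed {code : Λ → Instr Γ (Option Λ)} {code' : Λ' → Instr Γ (Option Λ')}
    (e : Λ → Λ') (exit : Option Λ')
    (he : ∀ l, code' (e l) = (code l).map fun o => o.elim exit fun l => some (e l))
    {l l' : Option Λ} {S S' : Store Γ} {t : ℕ} (h : Exec code l S t l' S') :
    Exec code' (l.elim exit fun l => some (e l)) S t (l'.elim exit fun l => some (e l)) S' := by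
  induction h with
  | refl => exact .refl _ _ _
  | step _ ih =>
    refine .step ?_
    rwa [he, Instr.next_map, Instr.store_map]

/-- A flowchart program: finitely many labelled instructions. -/
structure Flowchart {K : Type} (Γ : K → Type) where
  Λ : Type
  [fintype : Fintype Λ]
  start : Λ
  code : Λ → Instr Γ (Option Λ)

attribute [instance] Flowchart.fintype

/-- The flowchart `F`, started with the store `S`, exits within `t` steps with the store `S'`. -/
def Flowchart.Run (F : Flowchart Γ) (S : Store Γ) (t : ℕ) (S' : Store Γ) : Prop :=
  Exec F.code (some F.start) S t none S'

theorem Flowchart.Run.mono {F : Flowchart Γ} {S S' : Store Γ} {t u : ℕ} (h : F.Run S t S')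
    (htu : t ≤ u) : F.Run S u S' :=
  Exec.mono h htu

theorem Flowchart.Run.congr {F : Flowchart Γ} {S S' T T' : Store Γ} {t u : ℕ} (h : F.Run S t S')
    (hS : S = T) (htu : t ≤ u) (hS' : S' = T') : F.Run T u T' :=
  hS ▸ hS' ▸ h.mono htu

/-- The program that does nothing. -/
def Flowchart.skip {K : Type} (Γ : K → Type) : Flowchart Γ where
  Λ := Unit
  start := ()
  code _ := .jump none

theorem Flowchart.skip_run (S : Store Γ) : (Flowchart.skip Γ).Run S 1 S :=
  .step (.refl _ _ _)

/-- Push the symbol `s` on stack `k`. -/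
def Flowchart.push (k : K) (s : Γ k) : Flowchart Γ where
  Λ := Unit
  start := ()
  code _ := .push k s none

theorem Flowchart.push_run (k : K) (s : Γ k) (S : Store Γ) :
    (Flowchart.push k s).Run S 1 (Function.update S k (s :: S k)) :=
  .step (.refl _ _ _)

/-- Sequential composition. -/
def Flowchart.seq (F G : Flowchart Γ) : Flowchart Γ where
  Λ := F.Λ ⊕ G.Λ
  start := .inl F.start
  code
    | .inl l => (F.code l).map fun o => o.elim (some (.inr G.start)) fun l => some (.inl l)
    | .inr l => (G.code l).map fun o => o.elim none fun l => some (.inr l)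

theorem Flowchart.Run.seq {F G : Flowchart Γ} {S S' S'' : Store Γ} {t u : ℕ} (h : F.Run S t S')
    (h' : G.Run S' u S'') : (F.seq G).Run S (t + u) S'' :=
  (Exec.embed (code' := (F.seq G).code) Sum.inl (some (.inr G.start)) (fun _ => rfl) h).trans
    (Exec.embed (code' := (F.seq G).code) Sum.inr none (fun _ => rfl) h')

section Pop

variable [∀ k, Fintype (Γ k)]

/-- Pop stack `k` and continue according to the popped symbol. -/
def Flowchart.branch (k : K) (body : Option (Γ k) → Flowchart Γ) : Flowchart Γ where
  Λ := Option (Σ o, (body o).Λ)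
  start := none
  code
    | none => .pop k fun o => some (some ⟨o, (body o).start⟩)
    | some ⟨o, l⟩ => ((body o).code l).map fun o' => o'.elim none fun l => some (some ⟨o, l⟩)

theorem Flowchart.Run.branch {k : K} {body : Option (Γ k) → Flowchart Γ} {S S' : Store Γ} {t : ℕ}
    (h : (body (S k).head?).Run (Function.update S k (S k).tail) t S') :
    (Flowchart.branch k body).Run S (t + 1) S' :=
  .step (Exec.embed (code' := (Flowchart.branch k body).code) (fun l => some ⟨_, l⟩) none
    (fun _ => rfl) h)

/-- Pop stack `k` repeatedly, running the body as long as the popped symbol satisfies `c`. -/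
def Flowchart.loop (k : K) (c : Option (Γ k) → Bool) (body : Option (Γ k) → Flowchart Γ) :
    Flowchart Γ where
  Λ := Option (Σ o, (body o).Λ)
  start := none
  code
    | none => .pop k fun o => if c o then some (some ⟨o, (body o).start⟩) else none
    | some ⟨o, l⟩ => ((body o).code l).map fun o' => o'.elim (some none) fun l => some (some ⟨o, l⟩)

theorem Flowchart.loop_run_exit {k : K} {c : Option (Γ k) → Bool}
    {body : Option (Γ k) → Flowchart Γ} {S : Store Γ} (hc : c (S k).head? = false) :
    (Flowchart.loop k c body).Run S 1 (Function.update S k (S k).tail) := by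
  refine .step ?_
  simp only [Flowchart.loop, Instr.next, Instr.store, hc]
  exact .refl _ _ _

theorem Flowchart.Run.loop {k : K} {c : Option (Γ k) → Bool} {body : Option (Γ k) → Flowchart Γ}
    {S S' S'' : Store Γ} {t u : ℕ} (hc : c (S k).head? = true)
    (h : (body (S k).head?).Run (Function.update S k (S k).tail) t S')
    (h' : (Flowchart.loop k c body).Run S' u S'') :
    (Flowchart.loop k c body).Run S (t + u + 1) S'' := by
  have hbody := Exec.embed (code' := (Flowchart.loop k c body).code) (fun l => some ⟨_, l⟩)
    (some none) (fun _ => rfl) h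
  refine .step (Exec.trans (S' := S') (l' := some none) ?_ h')
  simpa [Flowchart.loop, Instr.next, Instr.store, hc] using hbody

end Pop

section Machine

open Turing

/-- The statement of a Turing machine for an instruction. The internal state holds the next
label, because the target of a jump may depend on the popped symbol only through that state. -/
def Instr.toStmt : Instr Γ (Option Λ) → Λ → TM2.Stmt Γ Λ (Option Λ)
  | .jump o, l => .load (fun _ => o) (.branch Option.isSome (.goto fun v => v.getD l) .halt)
  | .push k s o, l =>
    .push k (fun _ => s) (.load (fun _ => o)
      (.branch Option.isSome (.goto fun v => v.getD l) .halt))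
  | .pop k next, l =>
    .pop k (fun _ o => next o) (.branch Option.isSome (.goto fun v => v.getD l) .halt)

theorem Instr.stepAux_toStmt (i : Instr Γ (Option Λ)) (l : Λ) (v : Option Λ) (S : Store Γ) :
    TM2.stepAux (i.toStmt l) v S = ⟨i.next S, i.next S, i.store S⟩ := by
  cases i with
  | jump o => cases o <;> rfl
  | push k s o => cases o <;> rfl
  | pop k next =>
    simp only [toStmt, Instr.next, Instr.store, TM2.stepAux]
    cases next (S k).head? <;> rfl

variable [∀ k, Fintype (Γ k)] [Fintype K]

/-- The Turing machine with input stack `k₀` and output stack `k₁` that executes `F`. -/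
@[reducible]
def Flowchart.toTM (F : Flowchart Γ) (k₀ k₁ : K) : FinTM2 where
  K := K
  k₀ := k₀
  k₁ := k₁
  Γ := Γ
  Λ := F.Λ
  main := F.start
  σ := Option F.Λ
  initialState := none
  m l := (F.code l).toStmt l

/-- Halting configurations must carry the initial internal state, here `none`. -/
theorem Exec.iterate_step_toTM (F : Flowchart Γ) (k₀ k₁ : K) {l l' : Option F.Λ} {S S' : Store Γ}
    {t : ℕ} (h : Exec F.code l S t l' S') (hl' : l' = none) (v : Option F.Λ)
    (hv : l = none → v = none) :
    ∃ n ≤ t, (flip bind (F.toTM k₀ k₁).step)^[n] (some (⟨l, v, S⟩ : TM2.Cfg Γ F.Λ (Option F.Λ))) =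
      some (⟨none, none, S'⟩ : TM2.Cfg Γ F.Λ (Option F.Λ)) := by
  induction h generalizing v with
  | refl l S t =>
    subst hl'
    obtain rfl := hv rfl
    exact ⟨0, by omega, rfl⟩
  | @step l S t l' S' _ ih =>
    obtain ⟨n, hn, h⟩ := ih hl' ((F.code l).next S) id
    refine ⟨n + 1, by omega, ?_⟩
    rw [Function.iterate_succ_apply, ← h]
    congr 1
    exact congrArg some ((F.code l).stepAux_toStmt l v S)

theorem initList_toTM (F : Flowchart Γ) (k₀ k₁ : K) (w : List (Γ k₀)) :
    initList (F.toTM k₀ k₁) w =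
      (⟨some F.start, none, Function.update (fun _ => []) k₀ w⟩ :
        TM2.Cfg Γ F.Λ (Option F.Λ)) := by
  unfold initList
  congr 1
  refine funext fun j => ?_
  by_cases hj : j = k₀
  · have hj' : k₀ = j := hj.symm
    subst hj'
    simp
  · simp [hj]

theorem haltList_toTM (F : Flowchart Γ) (k₀ k₁ : K) (w : List (Γ k₁)) :
    haltList (F.toTM k₀ k₁) w =
      (⟨none, none, Function.update (fun _ => []) k₁ w⟩ : TM2.Cfg Γ F.Λ (Option F.Λ)) := by
  unfold haltList
  congr 1
  refine funext fun j => ?_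
  by_cases hj : j = k₁
  · have hj' : k₁ = j := hj.symm
    subst hj'
    simp
  · simp [hj]

theorem Flowchart.Run.outputsInTime {F : Flowchart Γ} {k₀ k₁ : K} {w : List (Γ k₀)}
    {w' : List (Γ k₁)} {t : ℕ}
    (h : F.Run (Function.update (fun _ => []) k₀ w) t (Function.update (fun _ => []) k₁ w')) :
    Nonempty (TM2OutputsInTime (F.toTM k₀ k₁) w (some w') t) := by
  obtain ⟨n, hn, hrun⟩ := h.iterate_step_toTM F k₀ k₁ rfl none (by simp)
  refine ⟨⟨⟨n, ?_⟩, hn⟩⟩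
  rw [initList_toTM, Option.map_some, haltList_toTM]
  exact hrun

end Machine

end Flowchart

section Programs

/-! ### Programs on binary trees -/

/-- A self-delimiting code for binary trees. -/
def treeBits : BinaryTree Unit → List Bool
  | .nil => [false]
  | .node _ a b => true :: (treeBits a ++ treeBits b)

theorem treeBits_append_inj {d d' : BinaryTree Unit} {r r' : List Bool}
    (h : treeBits d ++ r = treeBits d' ++ r') : d = d' ∧ r = r' := by
  induction d generalizing d' r r' with
  | nil => cases d' <;> simp_all [treeBits]
  | node _ a b iha ihb =>
    cases d' with
    | nil => simp [treeBits] at h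
    | node _ a' b' =>
      simp only [treeBits, List.cons_append, List.append_assoc, List.cons.injEq, true_and] at h
      obtain ⟨rfl, h₁⟩ := iha h
      obtain ⟨rfl, h₂⟩ := ihb h₁
      exact ⟨rfl, h₂⟩

theorem treeBits_prefix_iff {d d' : BinaryTree Unit} : treeBits d <+: treeBits d' ↔ d = d' := by
  refine ⟨fun ⟨r, h⟩ => (treeBits_append_inj (r' := []) (by simpa using h)).1, ?_⟩
  rintro rfl
  exact List.prefix_rfl

/-- The working store: the main stack holds data, the other three are empty between the runs of
the programs below. -/
inductive Reg : Type
  | main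
  | left
  | right
  | count
  deriving DecidableEq

instance Reg.instFintype : Fintype Reg where
  elems := {.main, .left, .right, .count}
  complete r := by cases r <;> decide

/-- The alphabets of the stacks: the input stack `none` has alphabet `Γ₀`, the working stacks hold
bits. -/
@[reducible]
def Alphabet (Γ₀ : Type) : Option Reg → Type
  | none => Γ₀
  | some _ => Bool

instance Alphabet.instFintype (Γ₀ : Type) [Fintype Γ₀] : ∀ k, Fintype (Alphabet Γ₀ k)
  | none => inferInstanceAs (Fintype Γ₀)
  | some _ => inferInstanceAs (Fintype Bool)

/-- Flowcharts over one input stack with alphabet `Γ₀` and the working stacks. -/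
abbrev Program (Γ₀ : Type) : Type 1 := Flowchart (Alphabet Γ₀)

variable {Γ₀ : Type}

/-- The store with input `i`, main stack `m`, left stack `x`, right stack `y` and counter `c`. -/
def store (i : List Γ₀) (m x y c : List Bool) : Store (Alphabet Γ₀)
  | none => i
  | some .main => m
  | some .left => x
  | some .right => y
  | some .count => c

/-- The store with main stack `m`, all other stacks being empty. -/
abbrev onMain (Γ₀ : Type) (m : List Bool) : Store (Alphabet Γ₀) :=
  store [] m [] [] []

section Stacks

variable (i : List Γ₀) (m x y c : List Bool)

@[simp] theorem store_none : store i m x y c none = i := rfl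

@[simp] theorem store_main : store i m x y c (some .main) = m := rfl

@[simp] theorem store_left : store i m x y c (some .left) = x := rfl

@[simp] theorem store_right : store i m x y c (some .right) = y := rfl

@[simp] theorem store_count : store i m x y c (some .count) = c := rfl

@[simp]
theorem update_store_none (l : List Γ₀) :
    Function.update (store i m x y c) none l = store l m x y c := by
  ext1 (_ | _ | _ | _ | _) <;> rfl

@[simp]
theorem update_store_main (l : List Bool) :
    Function.update (store i m x y c) (some .main) l = store i l x y c := by
  ext1 (_ | _ | _ | _ | _) <;> rfl

@[simp]
theorem update_store_left (l : List Bool) :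
    Function.update (store i m x y c) (some .left) l = store i m l y c := by
  ext1 (_ | _ | _ | _ | _) <;> rfl

@[simp]
theorem update_store_right (l : List Bool) :
    Function.update (store i m x y c) (some .right) l = store i m x l c := by
  ext1 (_ | _ | _ | _ | _) <;> rfl

@[simp]
theorem update_store_count (l : List Bool) :
    Function.update (store i m x y c) (some .count) l = store i m x y l := by
  ext1 (_ | _ | _ | _ | _) <;> rfl

end Stacks

variable {i : List Γ₀} {m x y c : List Bool} {S S' S'' : Store (Alphabet Γ₀)} {t u : ℕ}

/-- Push a bit on a working stack. -/
def pushReg (r : Reg) (b : Bool) : Program Γ₀ := Flowchart.push (Γ := Alphabet Γ₀) (some r) b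

theorem pushReg_run (r : Reg) (b : Bool) (S : Store (Alphabet Γ₀)) :
    (pushReg r b).Run S 1 (Function.update S (some r) (b :: S (some r))) :=
  Flowchart.push_run (Γ := Alphabet Γ₀) (some r) b S

theorem pushReg_main_run (b : Bool) :
    (pushReg .main b).Run (store i m x y c) 1 (store i (b :: m) x y c) := by
  simpa using pushReg_run .main b (store i m x y c)

/-- Push a word on the main stack. -/
def pushBits : List Bool → Program Γ₀
  | [] => Flowchart.skip _
  | b :: l => (pushBits l).seq (pushReg .main b)

theorem pushBits_run (l : List Bool) :
    (pushBits l).Run (store i m x y c) (l.length + 1) (store i (l ++ m) x y c) := by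
  induction l with
  | nil => exact Flowchart.skip_run _
  | cons b l ih => exact ih.seq (pushReg_main_run b)

variable [Fintype Γ₀]

/-- Pop a working stack and continue according to the popped bit. -/
def popReg (r : Reg) (body : Option Bool → Program Γ₀) : Program Γ₀ :=
  Flowchart.branch (Γ := Alphabet Γ₀) (some r) body

theorem popReg_run {r : Reg} {body : Option Bool → Program Γ₀}
    (h : (body (S (some r)).head?).Run (Function.update S (some r) (S (some r)).tail) t S') :
    (popReg r body).Run S (t + 1) S' :=
  Flowchart.Run.branch (Γ := Alphabet Γ₀) h

theorem popReg_main_run {body : Option Bool → Program Γ₀} {b : Bool}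
    (h : (body (some b)).Run (store i m x y c) t S) :
    (popReg .main body).Run (store i (b :: m) x y c) (t + 1) S :=
  popReg_run (by simpa using h)

/-- Empty a working stack, running the program `body` on every popped bit. -/
def forEach (r : Reg) (body : Bool → Program Γ₀) : Program Γ₀ :=
  Flowchart.loop (Γ := Alphabet Γ₀) (some r) Option.isSome fun o => o.elim (Flowchart.skip _) body

theorem forEach_run_nil {r : Reg} {body : Bool → Program Γ₀} (hr : S (some r) = []) :
    (forEach r body).Run S 1 S :=
  (Flowchart.loop_run_exit (Γ := Alphabet Γ₀) (by simp [hr])).congr rfl le_rfl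
    (Function.update_eq_self_iff.2 (by simp [hr]))

theorem forEach_run_cons {r : Reg} {body : Bool → Program Γ₀} {b : Bool} {l : List Bool}
    (hr : S (some r) = b :: l) (h : (body b).Run (Function.update S (some r) l) t S')
    (h' : (forEach r body).Run S' u S'') : (forEach r body).Run S (t + u + 1) S'' :=
  Flowchart.Run.loop (Γ := Alphabet Γ₀) (by simp [hr]) (by simpa [hr] using h) h'

/-- Empty a working stack. -/
def drain (r : Reg) : Program Γ₀ := forEach r fun _ => Flowchart.skip _

theorem drain_run (r : Reg) (S : Store (Alphabet Γ₀)) :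
    (drain r).Run S (2 * (S (some r)).length + 1) (Function.update S (some r) []) := by
  induction hr : S (some r) generalizing S with
  | nil =>
    exact (forEach_run_nil hr).congr rfl (by simp) (Function.update_eq_self_iff.2 hr.symm).symm
  | cons b l ih =>
    exact (forEach_run_cons hr (Flowchart.skip_run _) (ih _ (by simp))).congr rfl
      (by simp; omega) (by simp)

theorem drain_left_run : (drain (Γ₀ := Γ₀) .left).Run (store i m x y c) (2 * x.length + 1)
    (store i m [] y c) := by
  simpa using drain_run .left (store i m x y c)

theorem drain_count_run : (drain (Γ₀ := Γ₀) .count).Run (store i m x y c) (2 * c.length + 1)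
    (store i m x y []) := by
  simpa using drain_run .count (store i m x y c)

/-- Move the contents of a working stack to another one, in reverse order. -/
def move (r s : Reg) : Program Γ₀ := forEach r fun b => pushReg s b

theorem move_run {r s : Reg} (hrs : r ≠ s) (S : Store (Alphabet Γ₀)) :
    (move r s).Run S (2 * (S (some r)).length + 1)
      (Function.update (Function.update S (some s) ((S (some r)).reverse ++ S (some s)))
        (some r) []) := by
  induction hr : S (some r) generalizing S with
  | nil =>
    refine (forEach_run_nil hr).congr rfl (by simp) ?_
    rw [List.reverse_nil, List.nil_append, Function.update_eq_self, ← hr, Function.update_eq_self]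
  | cons b l ih =>
    have hne : some r ≠ some s := by simpa using hrs
    refine (forEach_run_cons hr (pushReg_run s b _) (ih _ (by simp [hne]))).congr rfl
      (by simp; omega) ?_
    rw [Function.update_idem, Function.update_self, Function.update_of_ne hne.symm,
      Function.update_comm hne, Function.update_idem, List.reverse_cons, List.append_assoc,
      List.singleton_append]

theorem move_left_right_run : (move (Γ₀ := Γ₀) .left .right).Run (store i m x y c)
    (2 * x.length + 1) (store i m [] (x.reverse ++ y) c) := by
  simpa using move_run (r := .left) (s := .right) (by decide) (store i m x y c)

theorem move_right_left_run : (move (Γ₀ := Γ₀) .right .left).Run (store i m x y c)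
    (2 * y.length + 1) (store i m (y.reverse ++ x) [] c) := by
  simpa using move_run (r := .right) (s := .left) (by decide) (store i m x y c)

theorem move_left_main_run : (move (Γ₀ := Γ₀) .left .main).Run (store i m x y c)
    (2 * x.length + 1) (store i (x.reverse ++ m) [] y c) := by
  simpa using move_run (r := .left) (s := .main) (by decide) (store i m x y c)

theorem move_left_count_run : (move (Γ₀ := Γ₀) .left .count).Run (store i m x y c)
    (2 * x.length + 1) (store i m [] y (x.reverse ++ c)) := by
  simpa using move_run (r := .left) (s := .count) (by decide) (store i m x y c)

/-- Move the contents of the left stack to both the main and the right stack, in reverse order. -/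
def copyLeft : Program Γ₀ := forEach .left fun b => (pushReg .main b).seq (pushReg .right b)

theorem copyLeft_run : (copyLeft (Γ₀ := Γ₀)).Run (store i m x y c) (3 * x.length + 1)
    (store i (x.reverse ++ m) [] (x.reverse ++ y) c) := by
  induction x generalizing m y with
  | nil => exact forEach_run_nil rfl
  | cons b x ih =>
    have hpush := (pushReg_run .main b (store i m x y c)).seq (pushReg_run .right b _)
    simp only [update_store_main, update_store_right, store_main, store_right] at hpush
    exact (forEach_run_cons (store_left ..) (by simpa using hpush)
      (ih (m := b :: m) (y := b :: y))).congr rfl (by simp; omega) (by simp)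

/-- The loop of `scan`; the length of the counter is the number of trees still to be read. -/
def scanLoop (Γ₀ : Type) [Fintype Γ₀] : Program Γ₀ :=
  forEach .count fun _ => popReg .main fun
    | some true => (pushReg .left true).seq ((pushReg .count true).seq (pushReg .count true))
    | some false => pushReg .left false
    | none => Flowchart.skip _

/-- Move the tree on top of the main stack to the left stack, in reverse order. -/
def scan (Γ₀ : Type) [Fintype Γ₀] : Program Γ₀ := (pushReg .count true).seq (scanLoop Γ₀)

theorem scanLoop_run (d : BinaryTree Unit) {b : Bool}
    (h : (scanLoop Γ₀).Run (store i m ((treeBits d).reverse ++ x) y c) t S) :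
    (scanLoop Γ₀).Run (store i (treeBits d ++ m) x y (b :: c))
      (5 * (treeBits d).length + t) S := by
  induction d generalizing m t b x c with
  | nil =>
    have hpush := pushReg_run .left false (store i m x y c)
    refine (forEach_run_cons (store_count ..) ?_ h).mono (t := 1 + 1 + t + 1)
      (by simp only [treeBits, List.length_singleton]; omega)
    rw [update_store_count]
    exact popReg_main_run (by simpa [treeBits] using hpush)
  | node _ d₁ d₂ ih₁ ih₂ =>
    have hpush := (pushReg_run .left true (store i (treeBits d₁ ++ (treeBits d₂ ++ m)) x y c)).seq
      ((pushReg_run .count true _).seq (pushReg_run .count true _))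
    simp only [update_store_left, update_store_count, store_left, store_count] at hpush
    have hrest := ih₁ (b := true) (c := true :: c) (x := true :: x)
      (ih₂ (b := true) (by simpa [treeBits] using h))
    refine (forEach_run_cons (store_count ..) ?_ hrest).mono (t := (1 + (1 + 1)) + 1 + _ + 1)
      (by simp only [treeBits, List.length_cons, List.length_append]; omega)
    simpa [treeBits] using popReg_main_run hpush

theorem scan_run (d : BinaryTree Unit) :
    (scan Γ₀).Run (store i (treeBits d ++ m) x y []) (5 * (treeBits d).length + 2)
      (store i m ((treeBits d).reverse ++ x) y []) := by
  have hexit : (scanLoop Γ₀).Run (store i m ((treeBits d).reverse ++ x) y []) 1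
      (store i m ((treeBits d).reverse ++ x) y []) := forEach_run_nil (store_count ..)
  refine ((pushReg_run .count true _).seq ?_).mono
    (t := 1 + (5 * (treeBits d).length + 1)) (by omega)
  simpa using scanLoop_run d hexit

/-- Remove the tree on top of the main stack. -/
def dropTop (Γ₀ : Type) [Fintype Γ₀] : Program Γ₀ := (scan Γ₀).seq (drain .left)

theorem dropTop_run (d : BinaryTree Unit) :
    (dropTop Γ₀).Run (onMain Γ₀ (treeBits d ++ m)) (7 * (treeBits d).length + 3) (onMain Γ₀ m) :=
  ((scan_run d).seq drain_left_run).congr rfl (by simp; omega) (by simp)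

/-- Exchange the two topmost trees of the main stack. -/
def swapTop (Γ₀ : Type) [Fintype Γ₀] : Program Γ₀ :=
  (scan Γ₀).seq ((move .left .right).seq
    ((scan Γ₀).seq ((move .right .left).seq (move .left .main))))

theorem swapTop_run (d d' : BinaryTree Unit) :
    (swapTop Γ₀).Run (onMain Γ₀ (treeBits d ++ (treeBits d' ++ m)))
      (11 * (treeBits d).length + 7 * (treeBits d').length + 7)
      (onMain Γ₀ (treeBits d' ++ (treeBits d ++ m))) :=
  ((scan_run d).seq (move_left_right_run.seq ((scan_run d').seq
    (move_right_left_run.seq move_left_main_run)))).congr rfl (by simp; omega) (by simp)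

/-- Duplicate the tree on top of the main stack. -/
def dup (Γ₀ : Type) [Fintype Γ₀] : Program Γ₀ :=
  (scan Γ₀).seq (copyLeft.seq ((move .right .left).seq (move .left .main)))

theorem dup_run (d : BinaryTree Unit) :
    (dup Γ₀).Run (onMain Γ₀ (treeBits d ++ m)) (12 * (treeBits d).length + 5)
      (onMain Γ₀ (treeBits d ++ (treeBits d ++ m))) :=
  ((scan_run d).seq (copyLeft_run.seq (move_right_left_run.seq move_left_main_run))).congr rfl
    (by simp; omega) (by simp)

/-- Empty the right stack while popping as many bits from the counter. Every bit that does not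
agree with its partner leaves a mark on the left stack. -/
def compare (Γ₀ : Type) [Fintype Γ₀] : Program Γ₀ :=
  forEach .right fun b => popReg .count fun o =>
    if o = some b then Flowchart.skip _ else pushReg .left true

theorem compare_run : ∃ n ≤ y.length, (n = 0 ↔ y <+: c) ∧
    (compare Γ₀).Run (store i m x y c) (3 * y.length + 1)
      (store i m (List.replicate n true ++ x) [] (c.drop y.length)) := by
  induction y generalizing x c with
  | nil => exact ⟨0, le_rfl, by simp, forEach_run_nil rfl⟩
  | cons b y ih =>
    by_cases hc : c.head? = some b
    · obtain ⟨n, hn, hiff, hrun⟩ := ih (x := x) (c := c.tail)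
      obtain ⟨c, rfl⟩ := List.head?_eq_some_iff.1 hc
      refine ⟨n, hn.trans (by simp), by simpa using hiff, ?_⟩
      refine (forEach_run_cons (store_right ..) (popReg_run (t := 1) ?_) hrun).congr rfl
        (by simp; omega) (by simp)
      simpa using Flowchart.skip_run _
    · obtain ⟨n, hn, -, hrun⟩ := ih (x := true :: x) (c := c.tail)
      refine ⟨n + 1, by simpa using hn, ?_, ?_⟩
      · simp only [Nat.add_eq_zero_iff, one_ne_zero, and_false, false_iff]
        rintro ⟨c', rfl⟩
        exact hc rfl
      · refine (forEach_run_cons (store_right ..) (popReg_run (t := 1) ?_) hrun).congr rfl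
          (by simp; omega) (by simp [List.replicate_succ'])
        simpa [hc] using pushReg_run .left true (store i m x y c.tail)

/-- The codes of the truth values. -/
def boolTree : Bool → BinaryTree Unit
  | false => .nil
  | true => .node () .nil .nil

/-- Replace the marks on the left stack by their absence, as a truth value on the main stack. -/
def reportUnmarked (Γ₀ : Type) [Fintype Γ₀] : Program Γ₀ :=
  popReg .left fun o => o.elim (pushBits (treeBits (boolTree true)))
    fun _ => (drain .left).seq (pushBits (treeBits (boolTree false)))

theorem reportUnmarked_run (n : ℕ) :
    (reportUnmarked Γ₀).Run (store i m (List.replicate n true) y c) (2 * n + 5)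
      (store i (treeBits (boolTree (n == 0)) ++ m) [] y c) := by
  cases n with
  | zero =>
    exact popReg_run (by simpa [treeBits, boolTree] using pushBits_run (treeBits (boolTree true)))
  | succ n =>
    refine (popReg_run (t := 2 * n + 1 + 2) ?_).mono (by omega)
    simpa [List.replicate_succ, treeBits, boolTree] using
      (drain_left_run (x := List.replicate n true)).seq (pushBits_run (treeBits (boolTree false)))

/-- Replace the two topmost trees of the main stack by the truth value of their equality. -/
def testEq (Γ₀ : Type) [Fintype Γ₀] : Program Γ₀ :=
  (scan Γ₀).seq ((move .left .right).seq ((scan Γ₀).seq ((move .left .count).seq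
    ((compare Γ₀).seq ((drain .count).seq (reportUnmarked Γ₀))))))

open Classical in
theorem testEq_run (d d' : BinaryTree Unit) :
    (testEq Γ₀).Run (onMain Γ₀ (treeBits d ++ (treeBits d' ++ m)))
      (12 * (treeBits d).length + 9 * (treeBits d').length + 20)
      (onMain Γ₀ (treeBits (boolTree (decide (d = d'))) ++ m)) := by
  obtain ⟨n, hn, hiff, hcompare⟩ := compare_run (Γ₀ := Γ₀) (i := []) (m := m) (x := [])
    (y := treeBits d) (c := treeBits d')
  have hn0 : (n == 0) = decide (d = d') := by
    rw [beq_eq_decide, decide_eq_decide, hiff, treeBits_prefix_iff]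
  have hreport := hcompare.seq (drain_count_run.seq
    ((reportUnmarked_run n).congr (by rw [List.append_nil]) le_rfl rfl))
  refine ((scan_run d).seq (move_left_right_run.seq ((scan_run d').seq (move_left_count_run.seq
    (hreport.congr (by simp) le_rfl rfl))))).congr rfl ?_ (by rw [hn0])
  simp only [List.append_nil, List.length_reverse, List.length_drop]
  omega

end Programs

/-! ### Functions computable in polynomial time -/

/-- Data that are coded by binary trees. -/
class Coded (α : Type) where
  code : α → BinaryTree Unit

open Coded (code)

/-- Codes that determine the coded object. -/
class CodeInjective (α : Type) [Coded α] : Prop where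
  code_injective : Function.Injective (code : α → BinaryTree Unit)

open CodeInjective (code_injective)

section Codes

variable {α β : Type} [Coded α] [Coded β]

/-- The word that represents `a` on a stack. -/
def bits (a : α) : List Bool := treeBits (code a)

/-- The size of `a`, namely the length of its representation. -/
def csize (a : α) : ℕ := (bits a).length

instance : Coded (BinaryTree Unit) := ⟨id⟩

instance : Coded Unit := ⟨fun _ => .nil⟩

instance : Coded Bool := ⟨boolTree⟩

instance : Coded (α × β) := ⟨fun p => .node () (code p.1) (code p.2)⟩

/-- The code of a list, as a comb. -/
def listTree : List α → BinaryTree Unit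
  | [] => .nil
  | a :: l => .node () (code a) (listTree l)

instance : Coded (List α) := ⟨listTree⟩

instance : Coded (Option α) := ⟨fun o => code o.toList⟩

theorem code_cons (a : α) (l : List α) : code (a :: l) = .node () (code a) (code l) := rfl

@[simp]
theorem bits_prod (a : α) (b : β) : bits (a, b) = true :: (bits a ++ bits b) := rfl

@[simp]
theorem bits_nil : bits ([] : List α) = [false] := rfl

@[simp]
theorem bits_cons (a : α) (l : List α) : bits (a :: l) = true :: (bits a ++ bits l) := rfl

@[simp]
theorem csize_prod (a : α) (b : β) : csize (a, b) = csize a + csize b + 1 := by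
  simp [csize]

@[simp]
theorem csize_nil : csize ([] : List α) = 1 := rfl

@[simp]
theorem csize_cons (a : α) (l : List α) : csize (a :: l) = csize a + csize l + 1 := by
  simp [csize]

theorem csize_bool_le (b : Bool) : csize b ≤ 3 := by
  cases b <;> decide

theorem csize_append (l l' : List α) : csize (l ++ l') + 1 = csize l + csize l' := by
  induction l with
  | nil => simp [add_comm]
  | cons a l ih =>
    simp only [List.cons_append, csize_cons]
    omega

theorem csize_le_of_mem {a : α} {l : List α} (h : a ∈ l) : csize a ≤ csize l := by
  induction l with
  | nil => simp at h
  | cons b l ih =>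
    rw [csize_cons]
    rcases List.mem_cons.1 h with rfl | h
    · omega
    · have := ih h
      omega

theorem length_le_csize (l : List α) : l.length ≤ csize l := by
  induction l with
  | nil => simp
  | cons b l ih =>
    rw [csize_cons, List.length_cons]
    omega

instance : CodeInjective Bool :=
  ⟨fun a b => by cases a <;> cases b <;> simp [code, boolTree]⟩

instance [CodeInjective α] [CodeInjective β] : CodeInjective (α × β) :=
  ⟨fun p q h => by
    simp only [code, BinaryTree.node.injEq, true_and] at h
    exact Prod.ext (code_injective h.1) (code_injective h.2)⟩

instance [CodeInjective α] : CodeInjective (List α) :=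
  ⟨fun l l' h => by
    induction l generalizing l' with
    | nil => cases l' with
      | nil => rfl
      | cons b l' => cases h
    | cons a l ih => cases l' with
      | nil => cases h
      | cons b l' =>
        rw [code_cons, code_cons, BinaryTree.node.injEq] at h
        rw [code_injective h.2.1, @ih l' h.2.2]⟩

instance [CodeInjective α] : CodeInjective (Option α) :=
  ⟨fun o o' h => by
    have hlist : o.toList = o'.toList := code_injective h
    cases o <;> cases o' <;> simp_all⟩

theorem code_inj [CodeInjective α] {a b : α} : code a = code b ↔ a = b :=
  code_injective.eq_iff

end Codes

section CodedRuns

variable {α β γ : Type} [Coded α] [Coded β] [Coded γ] {Γ₀ : Type}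
variable {m : List Bool} {t : ℕ} {S : Store (Alphabet Γ₀)}

theorem pushBits_bits_run (a : α) :
    (pushBits (bits a)).Run (onMain Γ₀ m) (csize a + 1) (onMain Γ₀ (bits a ++ m)) :=
  pushBits_run _

theorem pushReg_pair_run (a : α) (b : β) :
    (pushReg .main true).Run (onMain Γ₀ (bits a ++ (bits b ++ m))) 1
      (onMain Γ₀ (bits (a, b) ++ m)) :=
  (pushReg_main_run true).congr rfl le_rfl (by simp)

variable [Fintype Γ₀]

theorem popReg_pair_run {body : Option Bool → Program Γ₀} {a : α} {b : β}
    (h : (body (some true)).Run (onMain Γ₀ (bits a ++ (bits b ++ m))) t S) :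
    (popReg .main body).Run (onMain Γ₀ (bits (a, b) ++ m)) (t + 1) S := by
  rw [bits_prod, List.cons_append, List.append_assoc]
  exact popReg_main_run h

theorem dropTop_bits_run (a : α) :
    (dropTop Γ₀).Run (onMain Γ₀ (bits a ++ m)) (7 * csize a + 3) (onMain Γ₀ m) :=
  dropTop_run _

theorem swapTop_bits_run (a : α) (b : β) :
    (swapTop Γ₀).Run (onMain Γ₀ (bits a ++ (bits b ++ m))) (11 * csize a + 7 * csize b + 7)
      (onMain Γ₀ (bits b ++ (bits a ++ m))) :=
  swapTop_run _ _

theorem dup_bits_run (a : α) :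
    (dup Γ₀).Run (onMain Γ₀ (bits a ++ m)) (12 * csize a + 5)
      (onMain Γ₀ (bits a ++ (bits a ++ m))) :=
  dup_run _

open Classical in
theorem testEq_bits_run [CodeInjective α] (a b : α) :
    (testEq Γ₀).Run (onMain Γ₀ (bits a ++ (bits b ++ m))) (12 * csize a + 9 * csize b + 20)
      (onMain Γ₀ (bits (decide (a = b)) ++ m)) :=
  (testEq_run (code a) (code b)).congr rfl le_rfl (by simp only [code_inj]; rfl)

/-- A program for case distinction on a list, given programs for the two cases. The list is on top
of the main stack, above the data that both cases share. -/
def listMatch (G H : Program Γ₀) : Program Γ₀ :=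
  popReg .main fun
    | some true => (pushReg .main true).seq ((swapTop Γ₀).seq ((pushReg .main true).seq H))
    | some false => G
    | none => Flowchart.skip _

theorem listMatch_run_nil {G H : Program Γ₀} (hG : G.Run (onMain Γ₀ m) t S) :
    (listMatch G H).Run (onMain Γ₀ (bits ([] : List β) ++ m)) (t + 1) S :=
  popReg_main_run hG

theorem listMatch_run_cons {G H : Program Γ₀} {a : α} {b : β} {l : List β}
    (hH : H.Run (onMain Γ₀ (bits (a, b, l) ++ m)) t S) :
    (listMatch G H).Run (onMain Γ₀ (bits (b :: l) ++ (bits a ++ m)))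
      (11 * csize (b :: l) + 7 * csize a + t + 10) S := by
  have hcase := (pushReg_pair_run b l).seq ((swapTop_bits_run (b, l) a).seq
    ((pushReg_pair_run a (b, l)).seq hH))
  have hrun : (listMatch G H).Run (onMain Γ₀ (bits (b, l) ++ (bits a ++ m))) _ S :=
    popReg_pair_run hcase
  exact hrun.mono (by simp; omega)

/-- A program for folding over a list, given a program that replaces the coded triple of the head,
the tail and the state by the pair of the tail and the new state. The list is on top of the main
stack, above the state. -/
def foldLoop (W : Program Γ₀) : Program Γ₀ :=
  Flowchart.loop (Γ := Alphabet Γ₀) (some .main) (· == some true) fun _ =>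
    (pushReg .main true).seq ((pushReg .main true).seq
      (W.seq (popReg .main fun _ => Flowchart.skip _)))

theorem foldLoop_run_nil {W : Program Γ₀} :
    (foldLoop W).Run (onMain Γ₀ (bits ([] : List β) ++ m)) 1 (onMain Γ₀ m) :=
  (Flowchart.loop_run_exit (Γ := Alphabet Γ₀) (by simp)).congr rfl le_rfl (by simp)

theorem foldLoop_run_cons {W : Program Γ₀} {b : β} {l : List β} {s s' : γ} {u : ℕ}
    (hW : W.Run (onMain Γ₀ (bits ((b, l), s) ++ m)) t (onMain Γ₀ (bits (l, s') ++ m)))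
    (hloop : (foldLoop W).Run (onMain Γ₀ (bits l ++ (bits s' ++ m))) u S) :
    (foldLoop W).Run (onMain Γ₀ (bits (b :: l) ++ (bits s ++ m))) (t + u + 5) S := by
  have hbody := (pushReg_pair_run (m := bits s ++ m) b l).seq
    ((pushReg_pair_run (b, l) s).seq (hW.seq
      (popReg_pair_run (body := fun _ => Flowchart.skip _) (Flowchart.skip_run _))))
  refine (Flowchart.Run.loop (Γ := Alphabet Γ₀) (by simp) (hbody.congr ?_ le_rfl rfl) hloop).mono
    (by omega)
  simp

theorem foldLoop_run {W : Program Γ₀} {h : γ → β → γ} {l : List β} {s : γ}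
    (hW : ∀ l₁ b l₂, l = l₁ ++ b :: l₂ →
      W.Run (onMain Γ₀ (bits ((b, l₂), l₁.foldl h s) ++ m)) t
        (onMain Γ₀ (bits (l₂, h (l₁.foldl h s) b) ++ m))) :
    (foldLoop W).Run (onMain Γ₀ (bits l ++ (bits s ++ m))) (l.length * (t + 5) + 1)
      (onMain Γ₀ (bits (l.foldl h s) ++ m)) := by
  induction l generalizing s with
  | nil => exact foldLoop_run_nil.mono (by simp)
  | cons b l ih =>
    refine (foldLoop_run_cons (hW [] b l rfl) (ih fun l₁ c l₂ e => ?_)).mono ?_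
    · exact hW (b :: l₁) c l₂ (by rw [e, List.cons_append])
    · rw [List.length_cons, add_mul]
      omega

end CodedRuns

theorem eval_le_eval (p : Polynomial ℕ) {m n : ℕ} (h : m ≤ n) : p.eval m ≤ p.eval n := by
  induction p using Polynomial.induction_on' with
  | add p q hp hq =>
    simp only [Polynomial.eval_add]
    omega
  | monomial k a =>
    simp only [Polynomial.eval_monomial]
    gcongr

/-- The function `f` is computed in polynomial time: a program replaces the representation of `a` on
top of the main stack by that of `f a`. The output size is bounded explicitly, to make composition
immediate. -/
@[fun_prop]
def PolyTime {α β : Type} [Coded α] [Coded β] (f : α → β) : Prop :=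
  ∀ (Γ₀ : Type) [Fintype Γ₀], ∃ (F : Program Γ₀) (p : Polynomial ℕ), ∀ a : α,
    csize (f a) ≤ p.eval (csize a) ∧
    ∀ m : List Bool, F.Run (onMain Γ₀ (bits a ++ m)) (p.eval (csize a))
      (onMain Γ₀ (bits (f a) ++ m))

namespace PolyTime

section Closure

variable {Γ₀ : Type} [Fintype Γ₀] {α α' β γ σ : Type}
variable [Coded α] [Coded α'] [Coded β] [Coded γ] [Coded σ]

theorem exists_csize_le {f : α → β} (hf : PolyTime f) :
    ∃ p : Polynomial ℕ, ∀ a, csize (f a) ≤ p.eval (csize a) := by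
  obtain ⟨F, p, h⟩ := hf Unit
  exact ⟨p, fun a => (h a).1⟩

theorem of_code {f : α → β} {g : α' → γ} (hg : PolyTime g) (u : α → α')
    (hu : ∀ a, code (u a) = code a) (hf : ∀ a, code (f a) = code (g (u a))) : PolyTime f := by
  intro Γ₀ _
  obtain ⟨F, p, h⟩ := hg Γ₀
  refine ⟨F, p, fun a => ?_⟩
  simpa only [csize, bits, hu, ← hf] using h (u a)

theorem congr {f g : α → β} (hg : PolyTime g) (h : ∀ a, f a = g a) : PolyTime f :=
  (funext h : f = g) ▸ hg

@[fun_prop]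
theorem id : PolyTime (fun a : α => a) := fun _ _ =>
  ⟨Flowchart.skip _, Polynomial.X + 1, fun a =>
    ⟨by simp, fun _ => (Flowchart.skip_run _).mono (by simp)⟩⟩

@[fun_prop]
theorem comp {g : β → γ} {f : α → β} (hg : PolyTime g) (hf : PolyTime f) :
    PolyTime (fun a => g (f a)) := by
  intro Γ₀ _
  obtain ⟨F, p, hF⟩ := hf Γ₀
  obtain ⟨G, q, hG⟩ := hg Γ₀
  refine ⟨F.seq G, p + q.comp p, fun a => ?_⟩
  obtain ⟨hsize, hrun⟩ := hF a
  obtain ⟨hsize', hrun'⟩ := hG (f a)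
  have hq := eval_le_eval q hsize
  simp only [Polynomial.eval_add, Polynomial.eval_comp]
  exact ⟨by omega, fun m => ((hrun m).seq (hrun' m)).mono (by omega)⟩

@[fun_prop]
theorem const (b : β) : PolyTime (fun _ : α => b) := by
  intro Γ₀ _
  refine ⟨(dropTop Γ₀).seq (pushBits (bits b)),
    7 * Polynomial.X + 4 + Polynomial.C (csize b), fun a => ⟨by simp, fun m => ?_⟩⟩
  exact ((dropTop_bits_run a).seq (pushBits_bits_run b)).mono (by simp; omega)

@[fun_prop]
theorem prodMk {f : α → β} {g : α → γ} (hf : PolyTime f) (hg : PolyTime g) :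
    PolyTime (fun a => (f a, g a)) := by
  intro Γ₀ _
  obtain ⟨F, p, hF⟩ := hf Γ₀
  obtain ⟨G, q, hG⟩ := hg Γ₀
  refine ⟨(dup Γ₀).seq (F.seq ((swapTop Γ₀).seq (G.seq ((swapTop Γ₀).seq
    (pushReg .main true))))), 30 * Polynomial.X + 30 + 20 * p + 20 * q, fun a => ?_⟩
  obtain ⟨hsize, hrun⟩ := hF a
  obtain ⟨hsize', hrun'⟩ := hG a
  refine ⟨by simp; omega, fun m => ?_⟩
  refine ((dup_bits_run a).seq ((hrun _).seq ((swapTop_bits_run (f a) a).seq ((hrun' _).seq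
    ((swapTop_bits_run (g a) (f a)).seq (pushReg_pair_run (f a) (g a))))))).mono ?_
  simp
  omega

theorem fst : PolyTime (Prod.fst : α × β → α) := by
  intro Γ₀ _
  refine ⟨popReg .main fun _ => (swapTop Γ₀).seq (dropTop Γ₀), 20 * Polynomial.X + 20,
    fun ⟨a, b⟩ => ⟨by simp; omega, fun m => ?_⟩⟩
  exact (popReg_pair_run ((swapTop_bits_run a b).seq (dropTop_bits_run b))).mono (by simp; omega)

theorem snd : PolyTime (Prod.snd : α × β → β) := by
  intro Γ₀ _
  refine ⟨popReg .main fun _ => dropTop Γ₀, 20 * Polynomial.X + 20,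
    fun ⟨a, b⟩ => ⟨by simp; omega, fun m => ?_⟩⟩
  exact (popReg_pair_run (dropTop_bits_run a)).mono (by simp; omega)

@[fun_prop]
theorem fst_comp {f : α → β × γ} (hf : PolyTime f) : PolyTime (fun a => (f a).1) := fst.comp hf

@[fun_prop]
theorem snd_comp {f : α → β × γ} (hf : PolyTime f) : PolyTime (fun a => (f a).2) := snd.comp hf

theorem list_match {f : α → List β} {g : α → γ} {h : α → β → List β → γ} (hf : PolyTime f)
    (hg : PolyTime g) (hh : PolyTime fun p : α × β × List β => h p.1 p.2.1 p.2.2) :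
    PolyTime fun a => match f a with
      | [] => g a
      | b :: l => h a b l := by
  intro Γ₀ _
  obtain ⟨F, p, hF⟩ := hf Γ₀
  obtain ⟨G, q, hG⟩ := hg Γ₀
  obtain ⟨H, w, hH⟩ := hh Γ₀
  refine ⟨(dup Γ₀).seq (F.seq (listMatch G H)),
    20 * Polynomial.X + 20 + 20 * p + q + w.comp (Polynomial.X + p + 1), fun a => ?_⟩
  obtain ⟨hsize, hrun⟩ := hF a
  beta_reduce
  cases hfa : f a with
  | nil =>
    obtain ⟨hsizeG, hrunG⟩ := hG a
    refine ⟨by simp; omega, fun m => ?_⟩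
    refine ((dup_bits_run a).seq ((hrun _).seq (u := q.eval (csize a) + 1) ?_)).mono
      (by simp; omega)
    rw [hfa]
    exact listMatch_run_nil (hrunG m)
  | cons b l =>
    obtain ⟨hsizeH, hrunH⟩ := hH (a, b, l)
    rw [hfa] at hsize
    have hw : w.eval (csize (a, b, l)) ≤ w.eval (csize a + p.eval (csize a) + 1) :=
      eval_le_eval w (by simp at hsize ⊢; omega)
    refine ⟨(hsizeH.trans hw).trans (by simp), fun m => ?_⟩
    refine ((dup_bits_run a).seq ((hrun _).seq
      (u := 11 * csize (b :: l) + 7 * csize a + w.eval (csize (a, b, l)) + 10) ?_)).mono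
      (by simp only [Polynomial.eval_add, Polynomial.eval_mul, Polynomial.eval_comp,
        Polynomial.eval_X, Polynomial.eval_one, Polynomial.eval_ofNat]; omega)
    rw [hfa]
    exact listMatch_run_cons (hrunH m)

open Classical in
theorem decideEq [CodeInjective α] : PolyTime (fun p : α × α => decide (p.1 = p.2)) := by
  intro Γ₀ _
  refine ⟨popReg .main fun _ => testEq Γ₀, 15 * Polynomial.X + 30,
    fun ⟨a, b⟩ => ⟨(csize_bool_le _).trans (by simp), fun m => ?_⟩⟩
  exact (popReg_pair_run (testEq_bits_run a b)).mono (by simp; omega)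

theorem foldl_of_state_bound {L : α → List β} {s₀ : α → σ} {h : σ → β → σ} (hL : PolyTime L)
    (hs : PolyTime s₀) (hh : PolyTime fun p : σ × β => h p.1 p.2) (B : Polynomial ℕ)
    (hB : ∀ a l₁ l₂, L a = l₁ ++ l₂ → csize (l₁.foldl h (s₀ a)) ≤ B.eval (csize a)) :
    PolyTime fun a => (L a).foldl h (s₀ a) := by
  have hstep : PolyTime fun x : (β × List β) × σ => (x.1.2, h x.2 x.1.1) :=
    .prodMk (by fun_prop) (hh.comp (f := fun x : (β × List β) × σ => (x.2, x.1.1)) (by fun_prop))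
  intro Γ₀ _
  obtain ⟨W, w, hW⟩ := hstep Γ₀
  obtain ⟨P, p, hP⟩ := (hL.prodMk hs) Γ₀
  refine ⟨P.seq (popReg .main fun _ => foldLoop W),
    p + p * (w.comp (p + B + 1) + 5) + 2 + B, fun a => ⟨?_, fun m => ?_⟩⟩
  · have := hB a (L a) [] (by simp)
    simp
    omega
  · obtain ⟨hsize, hrun⟩ := hP a
    have hLsize : csize (L a) < p.eval (csize a) := by simp at hsize; omega
    have hlen := (length_le_csize (L a)).trans hLsize.le
    have hfold := foldLoop_run (m := m) (W := W)
      (t := w.eval (p.eval (csize a) + B.eval (csize a) + 1)) (h := h) (l := L a) (s := s₀ a)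
      fun l₁ b l₂ e => ((hW ((b, l₂), l₁.foldl h (s₀ a))).2 m).mono <| by
        have hstate := hB a l₁ (b :: l₂) e
        have hsuffix := csize_append l₁ (b :: l₂)
        rw [e] at hLsize
        refine eval_le_eval w ?_
        simp only [csize_prod, csize_cons] at hsuffix ⊢
        omega
    refine ((hrun m).seq (popReg_pair_run hfold)).mono ?_
    simp only [Polynomial.eval_add, Polynomial.eval_mul, Polynomial.eval_comp,
      Polynomial.eval_one, Polynomial.eval_ofNat]
    have := Nat.mul_le_mul_right (w.eval (p.eval (csize a) + B.eval (csize a) + 1) + 5) hlen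
    omega

end Closure

end PolyTime

section Library

theorem csize_foldl_le {β σ : Type} [Coded σ] {h : σ → β → σ} {l : List β} {c : ℕ}
    (hc : ∀ s, ∀ b ∈ l, csize (h s b) ≤ csize s + c) (s : σ) :
    csize (l.foldl h s) ≤ csize s + l.length * c := by
  induction l generalizing s with
  | nil => simp
  | cons b l ih =>
    have hl := ih (fun s b hb => hc s b (List.mem_cons_of_mem _ hb)) (h s b)
    have hb := hc s b List.mem_cons_self
    rw [List.foldl_cons, List.length_cons, add_mul]
    omega

variable {α β γ σ : Type} [Coded α] [Coded β] [Coded γ] [Coded σ]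

namespace PolyTime

@[fun_prop]
theorem cons {f : α → β} {g : α → List β} (hf : PolyTime f) (hg : PolyTime g) :
    PolyTime (fun a => f a :: g a) :=
  (hf.prodMk hg).of_code (fun a => a) (fun _ => rfl) fun _ => rfl

@[fun_prop]
theorem some {f : α → β} (hf : PolyTime f) : PolyTime (fun a => some (f a)) :=
  (hf.cons (const [])).of_code (fun a => a) (fun _ => rfl) fun _ => rfl

@[fun_prop]
theorem toList {f : α → Option β} (hf : PolyTime f) : PolyTime (fun a => (f a).toList) :=
  hf.of_code (fun a => a) (fun _ => rfl) fun _ => rfl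

@[fun_prop]
theorem cond {c : α → Bool} {f g : α → β} (hc : PolyTime c) (hf : PolyTime f)
    (hg : PolyTime g) : PolyTime (fun a => cond (c a) (f a) (g a)) := by
  -- The codes of `true` and `false` are those of a singleton and of the empty list.
  have hlist : PolyTime (fun a => if c a then [()] else []) :=
    hc.of_code (fun a => a) (fun _ => rfl) fun a => by cases c a <;> rfl
  exact (hlist.list_match (h := fun a _ _ => f a) hg (hf.comp fst)).congr fun a => by
    cases c a <;> rfl

@[fun_prop]
theorem and {f g : α → Bool} (hf : PolyTime f) (hg : PolyTime g) :
    PolyTime (fun a => f a && g a) :=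
  (hf.cond hg (const false)).congr fun a => by cases f a <;> rfl

@[fun_prop]
theorem or {f g : α → Bool} (hf : PolyTime f) (hg : PolyTime g) :
    PolyTime (fun a => f a || g a) :=
  (hf.cond (const true) hg).congr fun a => by cases f a <;> rfl

@[fun_prop]
theorem not {f : α → Bool} (hf : PolyTime f) : PolyTime (fun a => !f a) :=
  (hf.cond (const false) (const true)).congr fun a => by cases f a <;> rfl

end PolyTime

open Classical in
/-- Equality as a Boolean function, for types without a decision procedure for equality. -/
noncomputable def eqb {α : Type} (a b : α) : Bool := decide (a = b)

@[simp]
theorem eqb_iff {α : Type} {a b : α} : eqb a b = true ↔ a = b := by simp [eqb]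

@[simp]
theorem eqb_false_iff {α : Type} {a b : α} : eqb a b = false ↔ a ≠ b := by simp [eqb]

namespace PolyTime

@[fun_prop]
theorem eqb [CodeInjective β] {f g : α → β} (hf : PolyTime f) (hg : PolyTime g) :
    PolyTime (fun a => eqb (f a) (g a)) :=
  decideEq.comp (hf.prodMk hg)

theorem of_eq_some {f : α → Option β} (hf : PolyTime f) {g : α → β}
    (h : ∀ a, f a = Option.some (g a)) : PolyTime g := by
  have hpair : PolyTime (fun a => (g a, ([] : List Unit))) :=
    hf.of_code (fun a => a) (fun _ => rfl) fun a => by rw [h]; rfl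
  exact hpair.fst_comp

@[fun_prop]
theorem option_elim {f : α → Option β} {g : α → γ} {h : α → β → γ} (hf : PolyTime f)
    (hg : PolyTime g) (hh : PolyTime (fun p : α × β => h p.1 p.2)) :
    PolyTime (fun a => (f a).elim (g a) (h a)) :=
  (hf.toList.list_match (h := fun a b _ => h a b) hg
    (hh.comp (f := fun p : α × β × List β => (p.1, p.2.1)) (by fun_prop))).congr fun a => by
      cases f a <;> rfl

@[fun_prop]
theorem getD {f : α → Option β} {g : α → β} (hf : PolyTime f) (hg : PolyTime g) :
    PolyTime (fun a => (f a).getD (g a)) :=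
  (hf.option_elim hg snd).congr fun a => by cases f a <;> rfl

@[fun_prop]
theorem head? {f : α → List β} (hf : PolyTime f) : PolyTime (fun a => (f a).head?) :=
  (hf.list_match (h := fun _ b _ => Option.some b) (const none) (by fun_prop)).congr fun a => by
    cases f a <;> rfl

@[fun_prop]
theorem tail {f : α → List β} (hf : PolyTime f) : PolyTime (fun a => (f a).tail) :=
  (hf.list_match (h := fun _ _ l => l) (const []) (by fun_prop)).congr fun a => by
    cases f a <;> rfl

theorem foldl_of_bound {L : α → List β} {s₀ : α → σ} {h : α → σ → β → σ} (hL : PolyTime L)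
    (hs : PolyTime s₀) (hh : PolyTime (fun p : α × σ × β => h p.1 p.2.1 p.2.2))
    (B : Polynomial ℕ)
    (hB : ∀ a l₁ l₂, L a = l₁ ++ l₂ → csize (l₁.foldl (h a) (s₀ a)) ≤ B.eval (csize a)) :
    PolyTime (fun a => (L a).foldl (h a) (s₀ a)) := by
  have hpair (a : α) (l : List β) (s : σ) :
      l.foldl (fun (s : α × σ) b => (s.1, h s.1 s.2 b)) (a, s) = (a, l.foldl (h a) s) :=
    List.foldl_hom (Prod.mk a) fun _ _ => rfl
  have hstep : PolyTime (fun x : (α × σ) × β => (x.1.1, h x.1.1 x.1.2 x.2)) :=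
    .prodMk (by fun_prop)
      (hh.comp (f := fun x : (α × σ) × β => (x.1.1, x.1.2, x.2)) (by fun_prop))
  have hfold := foldl_of_state_bound (h := fun (s : α × σ) b => (s.1, h s.1 s.2 b)) hL
    (id.prodMk hs) hstep (Polynomial.X + B + 1) fun a l₁ l₂ e => by
      rw [hpair, csize_prod]
      simpa [add_assoc] using hB a l₁ l₂ e
  exact hfold.snd_comp.congr fun a => by rw [hpair]

theorem foldl {L : α → List β} {s₀ : α → σ} {h : α → σ → β → σ} (hL : PolyTime L)
    (hs : PolyTime s₀) (hh : PolyTime (fun p : α × σ × β => h p.1 p.2.1 p.2.2))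
    (B : Polynomial ℕ)
    (hB : ∀ a s, ∀ b ∈ L a, csize (h a s b) ≤ csize s + B.eval (csize a)) :
    PolyTime (fun a => (L a).foldl (h a) (s₀ a)) := by
  obtain ⟨p, hp⟩ := hs.exists_csize_le
  obtain ⟨q, hq⟩ := hL.exists_csize_le
  refine foldl_of_bound hL hs hh (p + q * B) fun a l₁ l₂ e => ?_
  have hlen : l₁.length ≤ q.eval (csize a) := by
    have hlist := (length_le_csize (L a)).trans (hq a)
    rw [e, List.length_append] at hlist
    omega
  calc csize (l₁.foldl (h a) (s₀ a))
      ≤ csize (s₀ a) + l₁.length * B.eval (csize a) :=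
        csize_foldl_le (fun s b hb => hB a s b (e ▸ List.mem_append_left _ hb)) _
    _ ≤ p.eval (csize a) + q.eval (csize a) * B.eval (csize a) := by
        gcongr
        exact hp a
    _ = (p + q * B).eval (csize a) := by simp

@[fun_prop]
theorem reverse {f : α → List β} (hf : PolyTime f) : PolyTime (fun a => (f a).reverse) := by
  obtain ⟨p, hp⟩ := hf.exists_csize_le
  refine (foldl (h := fun _ acc b => b :: acc) hf (const []) (by fun_prop) (p + 1)
    fun a s b hb => ?_).congr fun a => by simp
  have hb := (csize_le_of_mem hb).trans (hp a)
  simp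
  omega

@[fun_prop]
theorem append {f g : α → List β} (hf : PolyTime f) (hg : PolyTime g) :
    PolyTime (fun a => f a ++ g a) := by
  obtain ⟨p, hp⟩ := hf.reverse.exists_csize_le
  refine (foldl (h := fun _ acc b => b :: acc) hf.reverse hg (by fun_prop) (p + 1)
    fun a s b hb => ?_).congr fun a => by simp
  have hb := (csize_le_of_mem hb).trans (hp a)
  simp
  omega

@[fun_prop]
theorem flatMap {f : α → List β} {g : α → β → List γ} (hf : PolyTime f)
    (hg : PolyTime (fun p : α × β => g p.1 p.2)) : PolyTime (fun a => (f a).flatMap (g a)) := by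
  obtain ⟨p, hp⟩ := hf.exists_csize_le
  obtain ⟨q, hq⟩ := hg.exists_csize_le
  have hstep : PolyTime fun x : α × List γ × β => x.2.1 ++ g x.1 x.2.2 :=
    .append (by fun_prop) (hg.comp (f := fun x : α × List γ × β => (x.1, x.2.2)) (by fun_prop))
  refine (foldl (h := fun a acc b => acc ++ g a b) hf (const []) hstep
    (q.comp (Polynomial.X + p + 1)) fun a s b hb => ?_).congr fun a => List.flatMap_eq_foldl
  have hstep_size := csize_append s (g a b)
  have hpair : csize (a, b) ≤ csize a + p.eval (csize a) + 1 := by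
    have := (csize_le_of_mem hb).trans (hp a)
    rw [csize_prod]
    omega
  have hg_size := (hq (a, b)).trans (eval_le_eval q hpair)
  simp at hg_size ⊢
  omega

@[fun_prop]
theorem map {f : α → List β} {g : α → β → γ} (hf : PolyTime f)
    (hg : PolyTime (fun p : α × β => g p.1 p.2)) : PolyTime (fun a => (f a).map (g a)) :=
  (hf.flatMap (g := fun a b => [g a b]) (hg.cons (const []))).congr fun _ =>
    List.map_eq_flatMap

@[fun_prop]
theorem any {f : α → List β} {g : α → β → Bool} (hf : PolyTime f)
    (hg : PolyTime (fun p : α × β => g p.1 p.2)) : PolyTime (fun a => (f a).any (g a)) := by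
  have hor (a : α) (l : List β) (c : Bool) :
      l.foldl (fun acc b => acc || g a b) c = (c || l.any (g a)) := by
    induction l generalizing c with
    | nil => simp
    | cons b l ih => simp [ih, Bool.or_assoc]
  have hstep : PolyTime fun x : α × Bool × β => x.2.1 || g x.1 x.2.2 :=
    .or (by fun_prop) (hg.comp (f := fun x : α × Bool × β => (x.1, x.2.2)) (by fun_prop))
  exact (foldl (h := fun a acc b => acc || g a b) hf (const false) hstep 3
    fun _ _ _ _ => (csize_bool_le _).trans (by simp)).congr fun a => by rw [hor, Bool.false_or]

@[fun_prop]
theorem all {f : α → List β} {g : α → β → Bool} (hf : PolyTime f)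
    (hg : PolyTime (fun p : α × β => g p.1 p.2)) : PolyTime (fun a => (f a).all (g a)) :=
  (hf.any (g := fun a b => !g a b) hg.not).not.congr fun a => by simp [List.all_eq_not_any_not]

end PolyTime

/-- Zipping as a fold over the first list: the state consists of the remainder of the second list
and the reversed list of the pairs found so far. -/
def zipStep (s : List γ × List (β × γ)) (b : β) : List γ × List (β × γ) :=
  (s.1.tail, s.1.head?.elim s.2 fun c => (b, c) :: s.2)

theorem snd_foldl_zipStep {β γ : Type} (l : List β) (l' : List γ) (acc : List (β × γ)) :
    (l.foldl zipStep (l', acc)).2 = (l.zip l').reverse ++ acc := by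
  induction l generalizing l' acc with
  | nil => simp
  | cons b l ih => cases l' <;> simp [zipStep, ih]

namespace PolyTime

@[fun_prop]
theorem zip {f : α → List β} {g : α → List γ} (hf : PolyTime f) (hg : PolyTime g) :
    PolyTime (fun a => (f a).zip (g a)) := by
  obtain ⟨p, hp⟩ := hf.exists_csize_le
  refine (foldl (h := fun _ => zipStep) hf (hg.prodMk (const [])) (by unfold zipStep; fun_prop)
    (p + 1) fun a s b hb => ?_).snd_comp.reverse.congr fun a => by simp [snd_foldl_zipStep]
  have hb := (csize_le_of_mem hb).trans (hp a)
  obtain ⟨_ | ⟨c, l⟩, acc⟩ := s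
  · simp [zipStep]
  · simp [zipStep]
    omega

theorem map_family {ι : Type} {f : ι → α → β} (hf : ∀ i, PolyTime (f i)) (l : List ι) :
    PolyTime (fun a => l.map fun i => f i a) := by
  induction l with
  | nil => exact const []
  | cons i l ih => exact (hf i).cons ih

@[fun_prop]
theorem getElem? {f : α → List β} (hf : PolyTime f) (j : ℕ) : PolyTime (fun a => (f a)[j]?) := by
  induction j generalizing f with
  | zero => exact hf.head?.congr fun a => List.head?_eq_getElem?.symm
  | succ j ih => exact (ih hf.tail).congr fun a => List.getElem?_tail.symm

theorem exists_eq_on_list {ι : Type} [Coded ι] [CodeInjective ι] {c : α → ι} (hc : PolyTime c)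
    {g : ι → α → β} (hg : ∀ i, PolyTime (g i)) (i₀ : ι) (l : List ι) :
    ∃ k : α → β, PolyTime k ∧ ∀ a, c a ∈ l → k a = g (c a) a := by
  induction l with
  | nil => exact ⟨g i₀, hg _, by simp⟩
  | cons i l ih =>
    obtain ⟨k, hk, hkg⟩ := ih
    refine ⟨fun a => bif StackMachine.eqb (c a) i then g i a else k a, by fun_prop, fun a ha => ?_⟩
    by_cases hi : c a = i
    · simp [hi, eqb_iff.2]
    · simp [eqb_false_iff.2 hi, hkg a (List.mem_of_ne_of_mem hi ha)]

theorem finite_cases {ι : Type} [Finite ι] [Coded ι] [CodeInjective ι] {c : α → ι}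
    (hc : PolyTime c) {g : ι → α → β} (hg : ∀ i, PolyTime (g i)) :
    PolyTime (fun a => g (c a) a) := by
  have := Fintype.ofFinite ι
  rcases isEmpty_or_nonempty α with hα | ⟨⟨a₀⟩⟩
  · exact fun _ _ => ⟨Flowchart.skip _, 0, fun a => hα.elim a⟩
  · obtain ⟨k, hk, hkg⟩ := exists_eq_on_list hc hg (c a₀) Finset.univ.toList
    exact hk.congr fun a => (hkg a (by simp)).symm

end PolyTime

instance : Coded ℕ := ⟨fun n => code (Computability.encodeNat n)⟩

instance : CodeInjective ℕ :=
  ⟨code_injective.comp (g := code (α := List Bool))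
    (Function.LeftInverse.injective Computability.decode_encodeNat)⟩

instance {n : ℕ} : Coded (Fin n) := ⟨fun i => code (i : ℕ)⟩

instance {n : ℕ} : CodeInjective (Fin n) := ⟨(code_injective (α := ℕ)).comp Fin.val_injective⟩

/-- The values of a tuple in increasing order of the attributes. -/
def tupleList {V : Type} {U : Finset ℕ} (t : U → V) : List V :=
  List.ofFn fun j => t (U.orderIsoOfFin rfl j)

instance {V : Type} [Coded V] {U : Finset ℕ} : Coded (U → V) := ⟨fun t => code (tupleList t)⟩

namespace PolyTime

variable {U : Finset ℕ}

@[fun_prop]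
theorem tupleList {f : α → U → β} (hf : PolyTime f) : PolyTime (fun a => tupleList (f a)) :=
  hf.of_code (fun a => a) (fun _ => rfl) fun _ => rfl

@[fun_prop]
theorem tuple_apply (A : U) : PolyTime (fun t : U → β => t A) := by
  obtain ⟨j, rfl⟩ := (U.orderIsoOfFin rfl).surjective A
  exact (id.tupleList.getElem? j).of_eq_some fun t => by simp [StackMachine.tupleList]

@[fun_prop]
theorem tuple_of_apply {f : α → U → β} (hf : ∀ A, PolyTime (fun a => f a A)) : PolyTime f :=
  (map_family (fun j => hf (U.orderIsoOfFin rfl j)) (List.finRange U.card)).of_code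
    (fun a => a) (fun _ => rfl) fun a =>
      congrArg (code (α := List β)) (by simp [StackMachine.tupleList, List.ofFn_eq_map])

end PolyTime

end Library

/-! ### Decision problems in PTIME -/

section DecisionProblems

open Turing

theorem csize_le_length_mul {β : Type} [Coded β] {B : ℕ} (hB : ∀ b : β, csize b ≤ B) (l : List β) :
    csize l ≤ l.length * (B + 1) + 1 := by
  induction l with
  | nil => simp
  | cons b l ih =>
    have := hB b
    rw [csize_cons, List.length_cons]
    linarith

section Machine

variable {Γ₀ : Type} [Fintype Γ₀]

/-- Replace the code of a truth value by the truth value. -/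
def decodeBool (Γ₀ : Type) [Fintype Γ₀] : Program Γ₀ :=
  popReg .main fun o =>
    if o = some true then popReg .main fun _ => popReg .main fun _ => pushReg .main true
    else pushReg .main false

theorem decodeBool_run (b : Bool) :
    (decodeBool Γ₀).Run (onMain Γ₀ (bits b)) 4 (onMain Γ₀ [b]) := by
  cases b with
  | false => exact (popReg_main_run (t := 1) (pushReg_main_run false)).mono (by omega)
  | true =>
    exact popReg_main_run (t := 3) (popReg_main_run (popReg_main_run (pushReg_main_run true)))

variable [Coded Γ₀]

/-- Move the input word to the main stack, as the code of the reversed word. -/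
def loadInput (Γ₀ : Type) [Fintype Γ₀] [Coded Γ₀] : Program Γ₀ :=
  Flowchart.loop (Γ := Alphabet Γ₀) none Option.isSome fun o =>
    o.elim (Flowchart.skip _) fun c => pushBits (true :: bits c)

theorem loadInput_run {B : ℕ} (hB : ∀ c : Γ₀, csize c ≤ B) (w l : List Γ₀) :
    (loadInput Γ₀).Run (store w (bits l) [] [] []) (w.length * (B + 3) + 1)
      (onMain Γ₀ (bits (w.reverse ++ l))) := by
  induction w generalizing l with
  | nil =>
    exact (Flowchart.loop_run_exit (Γ := Alphabet Γ₀) (by simp)).congr rfl (by simp)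
      (by simp [onMain])
  | cons c w ih =>
    have hpush : (pushBits (true :: bits c)).Run (store w (bits l) [] [] []) (csize c + 2)
        (store w (bits (c :: l)) [] [] []) := by
      simpa [csize] using pushBits_run (i := w) (m := bits l) (true :: bits c)
    have hloop := Flowchart.Run.loop (Γ := Alphabet Γ₀)
      (S := store (c :: w) (bits l) [] [] []) (by simp) (by simpa using hpush) (ih (c :: l))
    refine hloop.congr rfl ?_ (by simp)
    have := hB c
    rw [List.length_cons]
    linarith

end Machine

variable {α Γ₀ : Type} [Coded α] [Coded Γ₀] {e : α → List Γ₀} {f : α → Bool}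

theorem PolyTime.exists_run_of_word [Finite Γ₀] (hf : PolyTime f)
    (he : ∀ a, code a = code (e a).reverse) :
    ∃ (F : Program Γ₀) (p : Polynomial ℕ), ∀ a,
      F.Run (store (e a) [] [] [] []) (p.eval (e a).length) (onMain Γ₀ [f a]) := by
  have := Fintype.ofFinite Γ₀
  obtain ⟨F, p, hF⟩ := hf Γ₀
  obtain ⟨B, hB⟩ := Finite.exists_le (fun c : Γ₀ => csize c)
  let q : Polynomial ℕ := .X * (.C B + 3) + 6 + p.comp (.X * (.C B + 1) + 1)
  refine ⟨(pushReg .main false).seq ((loadInput Γ₀).seq (F.seq (decodeBool Γ₀))), q, fun a => ?_⟩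
  have hbits : bits (e a).reverse = bits a := congrArg treeBits (he a).symm
  have hload := loadInput_run hB (e a) []
  have hrun := (hF a).2 []
  have hsize := csize_le_length_mul hB (e a).reverse
  rw [List.append_nil, hbits] at hload
  rw [List.append_nil, List.append_nil] at hrun
  rw [csize, hbits, List.length_reverse] at hsize
  have htime := eval_le_eval p hsize
  refine ((pushReg_main_run false).seq (hload.seq (hrun.seq (decodeBool_run (f a))))).mono ?_
  simp only [q, Polynomial.eval_add, Polynomial.eval_mul, Polynomial.eval_comp, Polynomial.eval_X,
    Polynomial.eval_C, Polynomial.eval_ofNat, Polynomial.eval_one, csize]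
  omega

/-- The word is read in reverse, as the program moves it from one stack to another. -/
theorem PolyTime.inPTIME [Finite Γ₀] {P : α → Prop} (hf : PolyTime f)
    (he : ∀ a, code a = code (e a).reverse) (hP : ∀ a, f a = true ↔ P a) :
    IncompleteDB.InPTIME e P := by
  have := Fintype.ofFinite Γ₀
  obtain ⟨F, p, hF⟩ := hf.exists_run_of_word he
  have hnil : store ([] : List Γ₀) [] [] [] [] = fun _ => [] := by
    ext1 (_ | _ | _ | _ | _) <;> rfl
  refine ⟨f, hP, ⟨{
    tm := F.toTM none (Option.some .main)
    inputAlphabet := .refl Γ₀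
    outputAlphabet := .refl Bool
    time := p
    outputsFun := fun a => Classical.choice ?_ }⟩⟩
  have hrun := hF a
  rw [onMain, ← update_store_none, ← update_store_main (l := [f a]), hnil] at hrun
  simpa [Computability.encodeBool] using Flowchart.Run.outputsInTime (Γ := Alphabet Γ₀) (k₀ := none)
    (k₁ := Option.some .main) hrun

end DecisionProblems

end StackMachine

namespace IncompleteDB

open StackMachine Coded CodeInjective

/-! ### Satisfiability of equalities and negated equalities -/

section Constraints

variable {T V : Type}

/-- A conjunction of possibly negated equalities: the list of the equalities and the list of the
negated ones, each given by the pair of its two sides. -/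
abbrev Constraints (T : Type) : Type := List (T × T) × List (T × T)

/-- An assignment of values satisfies the equalities and the negated equalities. -/
def Satisfies (g : T → V) (s : Constraints T) : Prop :=
  (∀ p ∈ s.1, g p.1 = g p.2) ∧ ∀ p ∈ s.2, g p.1 ≠ g p.2

/-- The substitution of `b` for `a`. -/
noncomputable def subst (a b x : T) : T := bif eqb x a then b else x

/-- The substitution of `b` for `a` in both sides of the constraints of a list. -/
noncomputable def substPairs (a b : T) (l : List (T × T)) : List (T × T) :=
  l.map fun p => (subst a b p.1, subst a b p.2)

/-- The elimination of the first equality `a = b` by the substitution of `b` for `a`. -/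
noncomputable def elimEq (s : Constraints T) : Constraints T :=
  s.1.head?.elim s fun p => (substPairs p.1 p.2 s.1.tail, substPairs p.1 p.2 s.2)

/-- No equality is both implied by the equalities and required to fail. -/
noncomputable def separable (s : Constraints T) : Bool :=
  (elimEq^[s.1.length] s).2.all fun p => !eqb p.1 p.2

theorem subst_self (a b : T) : subst a b a = b := by simp [subst, eqb]

theorem subst_of_ne {a x : T} (b : T) (h : x ≠ a) : subst a b x = x := by simp [subst, eqb, h]

theorem apply_subst {g : T → V} {a b : T} (h : g a = g b) (x : T) : g (subst a b x) = g x := by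
  by_cases hx : x = a
  · rw [hx, subst_self, h]
  · rw [subst_of_ne b hx]

theorem subst_right (a b : T) : subst a b b = b := by
  by_cases hb : b = a
  · rw [hb, subst_self]
  · rw [subst_of_ne b hb]

theorem satisfies_substPairs_iff {g : T → V} {a b : T} {l l' : List (T × T)} :
    Satisfies g (substPairs a b l, substPairs a b l') ↔ Satisfies (g ∘ subst a b) (l, l') := by
  simp only [Satisfies, substPairs, List.forall_mem_map, Function.comp_apply]

theorem exists_satisfies_elimEq_iff (s : Constraints T) :
    (∃ g : T → T, Satisfies g (elimEq s)) ↔ ∃ g : T → T, Satisfies g s := by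
  obtain ⟨_ | ⟨⟨a, b⟩, eqs⟩, neqs⟩ := s
  · exact Iff.rfl
  · change (∃ g, Satisfies g (substPairs a b eqs, substPairs a b neqs)) ↔ _
    simp only [satisfies_substPairs_iff]
    constructor
    · rintro ⟨g, heqs, hneqs⟩
      refine ⟨g ∘ subst a b, ?_, hneqs⟩
      rintro p (_ | ⟨_, hp⟩)
      · simp only [Function.comp_apply, subst_self, subst_right]
      · exact heqs p hp
    · rintro ⟨g, heqs, hneqs⟩
      have hg : g ∘ subst a b = g := funext (apply_subst (heqs (a, b) List.mem_cons_self))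
      exact ⟨g, hg.symm ▸ ⟨fun p hp => heqs p (List.mem_cons_of_mem _ hp), hneqs⟩⟩

theorem length_elimEq (s : Constraints T) : (elimEq s).1.length = s.1.length - 1 := by
  obtain ⟨_ | ⟨⟨a, b⟩, eqs⟩, neqs⟩ := s <;> simp [elimEq, substPairs]

theorem separable_iff {s : Constraints T} :
    separable s = true ↔ ∃ g : T → T, Satisfies g s := by
  have hsat (n : ℕ) :
      (∃ g : T → T, Satisfies g (elimEq^[n] s)) ↔ ∃ g : T → T, Satisfies g s := by
    induction n with
    | zero => rfl
    | succ n ih => rw [Function.iterate_succ_apply', exists_satisfies_elimEq_iff, ih]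
  have hlength (n : ℕ) : (elimEq^[n] s).1.length = s.1.length - n := by
    induction n with
    | zero => rfl
    | succ n ih => rw [Function.iterate_succ_apply', length_elimEq, ih, Nat.sub_sub]
  have heqs : (elimEq^[s.1.length] s).1 = [] := List.eq_nil_of_length_eq_zero (by simp [hlength])
  rw [← hsat s.1.length, separable]
  simp only [Satisfies, heqs, List.all_eq_true, Bool.not_eq_true', eqb_false_iff]
  refine ⟨fun h => ⟨id, by simp, h⟩, ?_⟩
  rintro ⟨g, -, h⟩ p hp e
  exact h p hp (congrArg g e)

variable [Coded T]

/-- The lists of constraints have at most `M` entries, whose sides have codes of length at most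
`M`. Unlike the length of the code of `s`, this is preserved by the elimination of equalities. -/
def SizeBounded (M : ℕ) (s : Constraints T) : Prop :=
  s.1.length ≤ M ∧ s.2.length ≤ M ∧ ∀ p ∈ s.1 ++ s.2, csize p.1 ≤ M ∧ csize p.2 ≤ M

theorem sizeBounded_csize (s : Constraints T) : SizeBounded (csize s) s := by
  obtain ⟨eqs, neqs⟩ := s
  have heqs := length_le_csize eqs
  have hneqs := length_le_csize neqs
  have happend := csize_append eqs neqs
  rw [SizeBounded, csize_prod]
  refine ⟨by lia, by lia, fun p hp => ?_⟩
  have hp := csize_le_of_mem hp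
  rw [csize_prod] at hp
  lia

theorem csize_subst_le {a b x : T} {M : ℕ} (hb : csize b ≤ M) (hx : csize x ≤ M) :
    csize (subst a b x) ≤ M := by
  by_cases hxa : x = a
  · rwa [hxa, subst_self]
  · rwa [subst_of_ne b hxa]

theorem SizeBounded.elimEq {M : ℕ} {s : Constraints T} (h : SizeBounded M s) :
    SizeBounded M (elimEq s) := by
  obtain ⟨_ | ⟨⟨a, b⟩, eqs⟩, neqs⟩ := s
  · exact h
  · obtain ⟨heqs, hneqs, hmem⟩ := h
    have hb : csize b ≤ M := (hmem (a, b) (by simp)).2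
    change SizeBounded M (substPairs a b eqs, substPairs a b neqs)
    refine ⟨?_, by simpa [substPairs] using hneqs, fun p hp => ?_⟩
    · simpa [substPairs] using (Nat.le_succ _).trans heqs
    · rw [substPairs, substPairs, ← List.map_append] at hp
      obtain ⟨q, hq, rfl⟩ := List.mem_map.1 hp
      have hq := hmem q (List.mem_cons_of_mem _ hq)
      exact ⟨csize_subst_le hb hq.1, csize_subst_le hb hq.2⟩

theorem csize_pairs_le {l : List (T × T)} {M : ℕ}
    (h : ∀ p ∈ l, csize p.1 ≤ M ∧ csize p.2 ≤ M) : csize l ≤ l.length * (2 * M + 2) + 1 := by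
  induction l with
  | nil => simp
  | cons p l ih =>
    have hp := h p List.mem_cons_self
    have hl := ih fun q hq => h q (List.mem_cons_of_mem _ hq)
    rw [csize_cons, csize_prod, List.length_cons, add_mul]
    lia

theorem SizeBounded.csize_le {M : ℕ} {s : Constraints T} (h : SizeBounded M s) :
    csize s ≤ 2 * (M * (2 * M + 2) + 1) + 1 := by
  obtain ⟨heqs, hneqs, hmem⟩ := h
  have heqs_size := csize_pairs_le fun p hp => hmem p (List.mem_append_left _ hp)
  have hneqs_size := csize_pairs_le fun p hp => hmem p (List.mem_append_right _ hp)
  have heqs := Nat.mul_le_mul_right (2 * M + 2) heqs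
  have hneqs := Nat.mul_le_mul_right (2 * M + 2) hneqs
  rw [csize_prod]
  lia

variable {α : Type} [Coded α] [CodeInjective T]

@[fun_prop]
theorem polyTime_subst {f g h : α → T} (hf : PolyTime f) (hg : PolyTime g) (hh : PolyTime h) :
    PolyTime (fun a => subst (f a) (g a) (h a)) := by
  unfold subst
  fun_prop

@[fun_prop]
theorem polyTime_substPairs {f g : α → T} {h : α → List (T × T)} (hf : PolyTime f)
    (hg : PolyTime g) (hh : PolyTime h) : PolyTime (fun a => substPairs (f a) (g a) (h a)) := by
  unfold substPairs
  fun_prop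

@[fun_prop]
theorem polyTime_elimEq {f : α → Constraints T} (hf : PolyTime f) :
    PolyTime (fun a => elimEq (f a)) := by
  unfold elimEq
  fun_prop

theorem polyTime_separable : PolyTime (separable : Constraints T → Bool) := by
  have hfold : PolyTime fun s : Constraints T => s.1.foldl (fun s' _ => elimEq s') s := by
    refine .foldl_of_bound (h := fun _ s' _ => elimEq s') (by fun_prop) .id (by fun_prop)
      (2 * (Polynomial.X * (2 * Polynomial.X + 2) + 1) + 1) fun s l _ _ => ?_
    have hbound : SizeBounded (csize s) (l.foldl (fun s' _ => elimEq s') s) :=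
      l.foldlRecOn _ (sizeBounded_csize s) fun _ h _ _ => h.elimEq
    simpa using hbound.csize_le
  have hall : PolyTime fun s : Constraints T =>
      (s.1.foldl (fun s' _ => elimEq s') s).2.all fun p => !eqb p.1 p.2 := by fun_prop
  exact hall.congr fun s => by rw [List.foldl_const, separable]

end Constraints

section Satisfiability

theorem exists_injOn_eqOn_of_finite {β D : Type} [Infinite D] {s s₀ : Set β} (hs : s.Finite)
    (hs₀ : s₀ ⊆ s) {f₀ : β → D} (hf₀ : s₀.InjOn f₀) :
    ∃ f : β → D, s.InjOn f ∧ s₀.EqOn f f₀ := by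
  classical
  obtain ⟨e, he, he_inj⟩ := Set.Finite.exists_injOn_of_encard_le (s := s) (t := (f₀ '' s₀)ᶜ) hs
    (by rw [((hs.subset hs₀).image f₀).infinite_compl.encard_eq]; exact le_top)
  refine ⟨s₀.piecewise f₀ e, ?_, s₀.piecewise_eqOn _ _⟩
  rw [← Set.union_sdiff_cancel hs₀, Set.injOn_union Set.disjoint_sdiff_right]
  have hcompl : (s \ s₀).EqOn (s₀.piecewise f₀ e) e := fun b hb =>
    s₀.piecewise_eq_of_notMem _ _ hb.2
  refine ⟨hf₀.congr (s₀.piecewise_eqOn _ _).symm,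
    (he_inj.mono Set.sdiff_subset).congr hcompl.symm, fun a ha b hb h => ?_⟩
  rw [s₀.piecewise_eqOn _ _ ha, hcompl hb] at h
  exact he hb.1 ⟨a, ha, h⟩

variable {D X : Type}

/-- The terms that are domain values. -/
def isConst : Term D X → Bool
  | .const _ => true
  | .var _ => false

/-- The terms that occur in the constraints. -/
def termsOf (s : Constraints (Term D X)) : List (Term D X) :=
  (s.1 ++ s.2).flatMap fun p => [p.1, p.2]

/-- The pairs of distinct domain values in a list of terms. -/
noncomputable def distinctConsts (l : List (Term D X)) : List (Term D X × Term D X) :=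
  l.flatMap fun a => l.flatMap fun b =>
    bif isConst a && (isConst b && !eqb a b) then [(a, b)] else []

/-- Satisfiability by a valuation: as the domain is infinite, it is enough that the terms can be
identified according to the equalities without identifying distinct domain values or the sides
of a negated equality. -/
noncomputable def sat (s : Constraints (Term D X)) : Bool :=
  separable (s.1, s.2 ++ distinctConsts (termsOf s))

theorem mem_distinctConsts {l : List (Term D X)} {p : Term D X × Term D X} :
    p ∈ distinctConsts l ↔ p.1 ∈ l ∧ p.2 ∈ l ∧ isConst p.1 = true ∧ isConst p.2 = true ∧
      p.1 ≠ p.2 := by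
  obtain ⟨x, y⟩ := p
  simp only [distinctConsts, List.mem_flatMap]
  constructor
  · rintro ⟨a, ha, b, hb, h⟩
    cases hc : isConst a && (isConst b && !eqb a b)
    · simp [hc] at h
    · rw [hc, cond_true, List.mem_singleton, Prod.mk.injEq] at h
      obtain ⟨rfl, rfl⟩ := h
      exact ⟨ha, hb, by simpa using hc⟩
  · rintro ⟨hx, hy, h⟩
    have hc : (isConst x && (isConst y && !eqb x y)) = true := by simpa using h
    exact ⟨x, hx, y, hy, by simp [hc]⟩

theorem mem_termsOf {s : Constraints (Term D X)} {p : Term D X × Term D X}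
    (hp : p ∈ s.1 ∨ p ∈ s.2) : p.1 ∈ termsOf s ∧ p.2 ∈ termsOf s := by
  have hp := List.mem_append.2 hp
  exact ⟨List.mem_flatMap.2 ⟨p, hp, by simp⟩, List.mem_flatMap.2 ⟨p, hp, by simp⟩⟩

theorem exists_injOn_comp_eq_eval [Infinite D] {T : Type} {P : Set (Term D X)} (hP : P.Finite)
    {g : Term D X → T} (hg : Set.InjOn (fun c => g (.const c)) {c | .const c ∈ P}) :
    ∃ (h : T → D) (ν : X → D), (g '' P).InjOn h ∧ ∀ a ∈ P, a.eval ν = h (g a) := by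
  obtain ⟨f₀, hf₀⟩ : ∃ f₀ : T → D, ∀ c, .const c ∈ P → f₀ (g (.const c)) = c :=
    ⟨_, fun _ hc => hg.leftInvOn_invFunOn hc⟩
  obtain ⟨h, hh, heq⟩ := exists_injOn_eqOn_of_finite (hP.image g)
    (s₀ := (fun c => g (.const c)) '' {c | .const c ∈ P}) (f₀ := f₀)
    (Set.image_subset_iff.2 fun _ hc => ⟨_, hc, rfl⟩) <| by
      rintro _ ⟨c, hc, rfl⟩ _ ⟨c', hc', rfl⟩ e
      simp only [hf₀ c hc, hf₀ c' hc'] at e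
      rw [e]
  refine ⟨h, fun x => h (g (.var x)), hh, ?_⟩
  rintro (c | x) hc
  · exact ((heq ⟨c, hc, rfl⟩).trans (hf₀ c hc)).symm
  · rfl

theorem sat_iff [Infinite D] {s : Constraints (Term D X)} :
    sat s = true ↔ ∃ ν : X → D, Satisfies (Term.eval ν) s := by
  rw [sat, separable_iff]
  constructor
  · rintro ⟨g, heqs, hneqs⟩
    have hconst : Set.InjOn (fun c => g (.const c)) {c : D | .const c ∈ termsOf s} := by
      intro c hc c' hc' e
      by_contra hne
      exact hneqs (.const c, .const c') (List.mem_append_right _ (mem_distinctConsts.2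
        ⟨hc, hc', rfl, rfl, by simpa using hne⟩)) e
    obtain ⟨h, ν, hinj, hν⟩ := exists_injOn_comp_eq_eval (List.finite_toSet _) hconst
    refine ⟨ν, fun p hp => ?_, fun p hp => ?_⟩
    · obtain ⟨ha, hb⟩ := mem_termsOf (.inl hp)
      rw [hν _ ha, hν _ hb, heqs p hp]
    · obtain ⟨ha, hb⟩ := mem_termsOf (.inr hp)
      rw [hν _ ha, hν _ hb]
      exact fun e => hneqs p (List.mem_append_left _ hp) (hinj ⟨_, ha, rfl⟩ ⟨_, hb, rfl⟩ e)
  · rintro ⟨ν, heqs, hneqs⟩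
    refine ⟨fun t => .const (t.eval ν), fun p hp => congrArg _ (heqs p hp), fun p hp => ?_⟩
    rcases List.mem_append.1 hp with hp | hp
    · simpa using hneqs p hp
    · obtain ⟨-, -, ha, hb, hne⟩ := mem_distinctConsts.1 hp
      obtain ⟨a | _, b | _⟩ := p <;> simp_all [isConst, Term.eval]

variable [Coded D] [Coded X]

instance : Coded (Term D X) :=
  ⟨fun
    | .const c => code (true, c)
    | .var x => code (false, x)⟩

instance [CodeInjective D] [CodeInjective X] : CodeInjective (Term D X) := ⟨by
  rintro (c | x) (c' | x') h
  · exact congrArg _ (Prod.ext_iff.1 (code_injective (α := Bool × D) h)).2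
  · have h' : code (true, code c) = code (false, code x') := h
    cases h'
  · have h' : code (false, code x) = code (true, code c') := h
    cases h'
  · exact congrArg _ (Prod.ext_iff.1 (code_injective (α := Bool × X) h)).2⟩

variable {α : Type} [Coded α]

@[fun_prop]
theorem polyTime_isConst {f : α → Term D X} (hf : PolyTime f) :
    PolyTime (fun a => isConst (f a)) := by
  have h : PolyTime (fun a => (isConst (f a), match f a with
      | .const c => code c
      | .var x => code x)) :=
    hf.of_code (fun a => a) (fun _ => rfl) fun a => by cases f a <;> rfl
  exact h.fst_comp

@[fun_prop]
theorem polyTime_sat [CodeInjective D] [CodeInjective X] {f : α → Constraints (Term D X)}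
    (hf : PolyTime f) : PolyTime (fun a => sat (f a)) := by
  refine polyTime_separable.comp (f := fun a =>
    ((f a).1, (f a).2 ++ distinctConsts (termsOf (f a)))) ?_
  unfold distinctConsts termsOf
  fun_prop

end Satisfiability

/-! ### Symbolic answers -/

section Algorithm

variable {S : RelSchema} {D X : Type} {U V : Finset ℕ}

/-- The column names and the rows of a component, as plain lists. -/
structure RawComponent (S : RelSchema) (D X : Type) where
  header : List (Field S)
  rows : List (List (Cell D X))

/-- A literal, with a flag that is `true` for equalities and `false` for negated equalities. -/
abbrev RawLiteral (D X : Type) : Type := Bool × Term D X × Term D X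

/-- A gWSD and a tuple, as plain lists; the values of the tuple are listed as terms, in increasing
order of the attributes. -/
structure RawInput (S : RelSchema) (D X : Type) where
  comps : List (RawComponent S D X)
  lits : List (RawLiteral D X)
  values : List (Term D X)

/-- A tuple of terms that belongs to the answer of a query in all worlds in which the chosen rows
have the required entries and the valuation satisfies the required equalities. -/
structure SymbolicAnswer (S : RelSchema) (D X : Type) (U : Finset ℕ) where
  tuple : U → Term D X
  entries : List (Field S × Term D X)
  eqs : List (Term D X × Term D X)

/-- The entry of the row `r` in the field `f`, provided that `f` occurs in the header and that the
entry is not `⊥`. -/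
noncomputable def RawComponent.entry? (C : RawComponent S D X) (r : List (Cell D X))
    (f : Field S) : Option (Term D X) :=
  ((C.header.zip r).flatMap fun z => bif eqb z.1 f then z.2.toList else []).head?

/-- The tuple of `R_i` with identifier `d` in the row `r`. Missing entries are replaced by `x₀`;
this is harmless because the row is required to have these entries. -/
noncomputable def RawComponent.symbolicTuple (C : RawComponent S D X) (x₀ : Term D X)
    (i : Fin S.numRels) (r : List (Cell D X)) (d : ℕ) : SymbolicAnswer S D X (S.attrs i) where
  tuple A := (C.entry? r ⟨i, d, A⟩).getD x₀
  entries := (S.attrs i).attach.toList.map fun A => (⟨i, d, A⟩, (C.entry? r ⟨i, d, A⟩).getD x₀)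
  eqs := []

/-- The symbolic tuples of `R_i`. -/
noncomputable def relAnswers (x₀ : Term D X) (i : Fin S.numRels)
    (cs : List (RawComponent S D X)) : List (SymbolicAnswer S D X (S.attrs i)) :=
  cs.flatMap fun C => C.rows.flatMap fun r => C.header.flatMap fun f =>
    bif eqb f.rel i then [C.symbolicTuple x₀ i r f.tid] else []

/-- A disjunctive normal form of a selection condition on a tuple of terms. -/
def SelCond.alternatives : SelCond D U → (U → Term D X) → List (List (Term D X × Term D X))
  | .top, _ => [[]]
  | .eqAttr A B, τ => [[(τ A, τ B)]]
  | .eqConst A c, τ => [[(τ A, .const c)]]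
  | .and p q, τ => (p.alternatives τ).flatMap fun e => (q.alternatives τ).map fun e' => e ++ e'
  | .or p q, τ => p.alternatives τ ++ q.alternatives τ

/-- The concatenation of two tuples; the first one takes precedence on common attributes. -/
def unionTuple {T : Type} (s : U → T) (t : V → T) (a : ↥(U ∪ V)) : T :=
  if h : a.1 ∈ U then s ⟨a.1, h⟩ else t ⟨a.1, (Finset.mem_union.1 a.2).resolve_left h⟩

namespace SymbolicAnswer

/-- The symbolic answers obtained by selection, one for each way to satisfy the condition. -/
def select (p : SelCond D U) (s : SymbolicAnswer S D X U) : List (SymbolicAnswer S D X U) :=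
  (p.alternatives s.tuple).map fun e => ⟨s.tuple, s.entries, e ++ s.eqs⟩

/-- The symbolic counterpart of projection. -/
def project (h : V ⊆ U) (s : SymbolicAnswer S D X U) : SymbolicAnswer S D X V :=
  ⟨fun a => s.tuple ⟨a.1, h a.2⟩, s.entries, s.eqs⟩

/-- The symbolic counterpart of the product. -/
def product (s : SymbolicAnswer S D X U) (s' : SymbolicAnswer S D X V) :
    SymbolicAnswer S D X (U ∪ V) :=
  ⟨unionTuple s.tuple s'.tuple, s.entries ++ s'.entries, s.eqs ++ s'.eqs⟩

/-- The symbolic counterpart of renaming. -/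
def rename (f : U ≃ V) (s : SymbolicAnswer S D X U) : SymbolicAnswer S D X V :=
  ⟨fun b => s.tuple (f.symm b), s.entries, s.eqs⟩

end SymbolicAnswer

/-- The symbolic answers to a query. As the query is fixed, each of them combines boundedly many
symbolic tuples, so their number is polynomial in the size of the components. -/
noncomputable def PosQuery.answers (x₀ : Term D X) : {U : Finset ℕ} → PosQuery S D U →
    List (RawComponent S D X) → List (SymbolicAnswer S D X U)
  | _, .rel i, cs => relAnswers x₀ i cs
  | _, .select p q, cs => (q.answers x₀ cs).flatMap fun s => s.select p
  | _, .project _ h q, cs => (q.answers x₀ cs).map fun s => s.project h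
  | _, .product _ q r, cs =>
      (q.answers x₀ cs).flatMap fun s => (r.answers x₀ cs).map fun s' => s.product s'
  | _, .union q r, cs => q.answers x₀ cs ++ r.answers x₀ cs
  | _, .rename f q, cs => (q.answers x₀ cs).map fun s => s.rename f

/-- Every component has a row with the required entries. -/
noncomputable def compatible (cs : List (RawComponent S D X))
    (entries : List (Field S × Term D X)) : Bool :=
  cs.all fun C => C.rows.any fun r => (C.header.zip r).all fun z => entries.all fun p =>
    !eqb p.1 z.1 || eqb (some p.2) z.2

/-- The fields of the required entries occur in the components. -/
noncomputable def covered (cs : List (RawComponent S D X))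
    (entries : List (Field S × Term D X)) : Bool :=
  entries.all fun p => cs.any fun C => C.header.any fun f => eqb f p.1

/-- The two sides of the equalities (`b = true`) or of the negated equalities (`b = false`). -/
noncomputable def sidesOf (b : Bool) (ls : List (RawLiteral D X)) : List (Term D X × Term D X) :=
  ls.flatMap fun l => bif eqb l.1 b then [l.2] else []

/-- The decision procedure for tuple q-possibility. -/
noncomputable def decidePossible (x₀ : Term D X) (q : PosQuery S D U) (x : RawInput S D X) :
    Bool :=
  (q.answers x₀ x.comps).any fun s => (covered x.comps s.entries && compatible x.comps s.entries) &&
    sat (sidesOf true x.lits ++ s.eqs ++ (tupleList s.tuple).zip x.values, sidesOf false x.lits)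

end Algorithm

section PolyTime

variable {S : RelSchema} {D X : Type} {U V : Finset ℕ} {α : Type} [Coded α]

instance : Coded (Field S) := ⟨fun f => code (f.rel, f.tid, (f.attr : ℕ))⟩

instance : CodeInjective (Field S) := ⟨by
  rintro ⟨i, d, a⟩ ⟨i', d', a'⟩ h
  have h' : (i, d, (a : ℕ)) = (i', d', (a' : ℕ)) := code_injective h
  simp only [Prod.mk.injEq] at h'
  obtain ⟨rfl, rfl, h'⟩ := h'
  rw [Subtype.ext h']⟩

theorem polyTime_field_parts {f : α → Field S} (hf : PolyTime f) :
    PolyTime (fun a => ((f a).rel, (f a).tid, ((f a).attr : ℕ))) :=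
  hf.of_code (fun a => a) (fun _ => rfl) fun _ => rfl

@[fun_prop]
theorem polyTime_rel {f : α → Field S} (hf : PolyTime f) : PolyTime (fun a => (f a).rel) :=
  (polyTime_field_parts hf).fst_comp

@[fun_prop]
theorem polyTime_tid {f : α → Field S} (hf : PolyTime f) : PolyTime (fun a => (f a).tid) :=
  (polyTime_field_parts hf).snd_comp.fst_comp

@[fun_prop]
theorem polyTime_field_mk {f : α → ℕ} (hf : PolyTime f) (i : Fin S.numRels) (A : S.attrs i) :
    PolyTime (fun a => (⟨i, f a, A⟩ : Field S)) :=
  ((PolyTime.const i).prodMk (hf.prodMk (.const (A : ℕ)))).of_code (fun a => a)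
    (fun _ => rfl) fun _ => rfl

variable [Coded D] [Coded X]

instance : Coded (RawComponent S D X) := ⟨fun C => code (C.header, C.rows)⟩

instance : Coded (RawInput S D X) := ⟨fun x => code (x.comps, x.lits, x.values)⟩

instance : Coded (SymbolicAnswer S D X U) := ⟨fun s => code (s.tuple, s.entries, s.eqs)⟩

section Structures

theorem polyTime_rawComponent_parts {f : α → RawComponent S D X} (hf : PolyTime f) :
    PolyTime (fun a => ((f a).header, (f a).rows)) :=
  hf.of_code (fun a => a) (fun _ => rfl) fun _ => rfl

@[fun_prop]
theorem polyTime_header {f : α → RawComponent S D X} (hf : PolyTime f) :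
    PolyTime (fun a => (f a).header) :=
  (polyTime_rawComponent_parts hf).fst_comp

@[fun_prop]
theorem polyTime_rows {f : α → RawComponent S D X} (hf : PolyTime f) :
    PolyTime (fun a => (f a).rows) :=
  (polyTime_rawComponent_parts hf).snd_comp

theorem polyTime_rawInput_parts {f : α → RawInput S D X} (hf : PolyTime f) :
    PolyTime (fun a => ((f a).comps, (f a).lits, (f a).values)) :=
  hf.of_code (fun a => a) (fun _ => rfl) fun _ => rfl

@[fun_prop]
theorem polyTime_comps {f : α → RawInput S D X} (hf : PolyTime f) :
    PolyTime (fun a => (f a).comps) :=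
  (polyTime_rawInput_parts hf).fst_comp

@[fun_prop]
theorem polyTime_lits {f : α → RawInput S D X} (hf : PolyTime f) :
    PolyTime (fun a => (f a).lits) :=
  (polyTime_rawInput_parts hf).snd_comp.fst_comp

@[fun_prop]
theorem polyTime_values {f : α → RawInput S D X} (hf : PolyTime f) :
    PolyTime (fun a => (f a).values) :=
  (polyTime_rawInput_parts hf).snd_comp.snd_comp

theorem polyTime_symbolicAnswer_parts {f : α → SymbolicAnswer S D X U} (hf : PolyTime f) :
    PolyTime (fun a => ((f a).tuple, (f a).entries, (f a).eqs)) :=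
  hf.of_code (fun a => a) (fun _ => rfl) fun _ => rfl

@[fun_prop]
theorem polyTime_tuple {f : α → SymbolicAnswer S D X U} (hf : PolyTime f) :
    PolyTime (fun a => (f a).tuple) :=
  (polyTime_symbolicAnswer_parts hf).fst_comp

@[fun_prop]
theorem polyTime_entries {f : α → SymbolicAnswer S D X U} (hf : PolyTime f) :
    PolyTime (fun a => (f a).entries) :=
  (polyTime_symbolicAnswer_parts hf).snd_comp.fst_comp

@[fun_prop]
theorem polyTime_eqs {f : α → SymbolicAnswer S D X U} (hf : PolyTime f) :
    PolyTime (fun a => (f a).eqs) :=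
  (polyTime_symbolicAnswer_parts hf).snd_comp.snd_comp

@[fun_prop]
theorem polyTime_symbolicAnswer_mk {f : α → U → Term D X} {g : α → List (Field S × Term D X)}
    {h : α → List (Term D X × Term D X)} (hf : PolyTime f) (hg : PolyTime g) (hh : PolyTime h) :
    PolyTime (fun a => (⟨f a, g a, h a⟩ : SymbolicAnswer S D X U)) :=
  (hf.prodMk (hg.prodMk hh)).of_code (fun a => a) (fun _ => rfl) fun _ => rfl

end Structures

@[fun_prop]
theorem polyTime_entry? {f : α → RawComponent S D X} {g : α → List (Cell D X)} {h : α → Field S}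
    (hf : PolyTime f) (hg : PolyTime g) (hh : PolyTime h) :
    PolyTime (fun a => (f a).entry? (g a) (h a)) := by
  unfold RawComponent.entry?
  fun_prop

@[fun_prop]
theorem polyTime_symbolicTuple {f : α → RawComponent S D X} (x₀ : Term D X) (i : Fin S.numRels)
    {g : α → List (Cell D X)} {h : α → ℕ} (hf : PolyTime f) (hg : PolyTime g) (hh : PolyTime h) :
    PolyTime (fun a => (f a).symbolicTuple x₀ i (g a) (h a)) :=
  polyTime_symbolicAnswer_mk (by fun_prop) (.map_family (fun A => by fun_prop) _) (by fun_prop)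

theorem polyTime_relAnswers (x₀ : Term D X) (i : Fin S.numRels) : PolyTime (relAnswers x₀ i) := by
  unfold relAnswers
  fun_prop

@[fun_prop]
theorem polyTime_alternatives (p : SelCond D U) {f : α → U → Term D X} (hf : PolyTime f) :
    PolyTime (fun a => p.alternatives (f a)) := by
  induction p generalizing α with unfold SelCond.alternatives
  | and p q ihp ihq =>
    have hq := ihq (f := fun x : α × List (Term D X × Term D X) => f x.1) (by fun_prop)
    exact (ihp hf).flatMap (hq.map (by fun_prop))
  | or p q ihp ihq => exact (ihp hf).append (ihq hf)
  | _ => fun_prop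

@[fun_prop]
theorem polyTime_unionTuple {f : α → U → Term D X} {g : α → V → Term D X} (hf : PolyTime f)
    (hg : PolyTime g) : PolyTime (fun a => unionTuple (f a) (g a)) := by
  refine .tuple_of_apply fun A => ?_
  unfold unionTuple
  split <;> fun_prop

theorem polyTime_answers (x₀ : Term D X) (q : PosQuery S D U) :
    PolyTime (fun cs : List (RawComponent S D X) => q.answers x₀ cs) := by
  induction q with unfold PosQuery.answers
  | rel i => exact polyTime_relAnswers x₀ i
  | select p q ih =>
    unfold SymbolicAnswer.select
    fun_prop
  | project V h q ih =>
    unfold SymbolicAnswer.project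
    fun_prop
  | product h q r ihq ihr =>
    unfold SymbolicAnswer.product
    fun_prop
  | union q r ihq ihr => exact ihq.append ihr
  | rename f q ih =>
    unfold SymbolicAnswer.rename
    fun_prop

@[fun_prop]
theorem polyTime_sidesOf (b : Bool) {f : α → List (RawLiteral D X)} (hf : PolyTime f) :
    PolyTime (fun a => sidesOf b (f a)) := by
  unfold sidesOf
  fun_prop

@[fun_prop]
theorem polyTime_covered {f : α → List (RawComponent S D X)} {g : α → List (Field S × Term D X)}
    (hf : PolyTime f) (hg : PolyTime g) : PolyTime (fun a => covered (f a) (g a)) := by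
  unfold covered
  fun_prop

variable [CodeInjective D] [CodeInjective X]

@[fun_prop]
theorem polyTime_compatible {f : α → List (RawComponent S D X)}
    {g : α → List (Field S × Term D X)} (hf : PolyTime f) (hg : PolyTime g) :
    PolyTime (fun a => compatible (f a) (g a)) := by
  unfold compatible
  fun_prop

theorem polyTime_decidePossible (x₀ : Term D X) (q : PosQuery S D U) :
    PolyTime (decidePossible x₀ q) := by
  have hanswers := polyTime_answers x₀ q
  unfold decidePossible
  fun_prop

end PolyTime

section Correctness

variable {S : RelSchema} {D X : Type} {U V : Finset ℕ}

/-- The database given by a choice `ω` of the entries of all fields and a valuation. A field that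
occurs in no component has the entry `⊥`. -/
def worldDB (ω : Field S → Cell D X) (ν : X → D) : Database S D := fun i =>
  {t | ∃ d, ∃ s : Tuple (Term D X) (S.attrs i),
    (∀ a, ω ⟨i, d, a⟩ = some (s a)) ∧ t = fun a => (s a).eval ν}

/-- The entries `ω` choose one row of every component. -/
def Picks (W : GWSD S D X) (ω : Field S → Cell D X) : Prop :=
  (∀ C ∈ W.comps, ∃ r ∈ C.rows, ∀ j, ω (C.field j) = r j) ∧
    ∀ f, ω f ≠ none → ∃ C ∈ W.comps, f ∈ C.schema

theorem apply_inlineInv_eq_worldDB {F : Set (Field S)} (conds : List (Literal D X))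
    {ω : Field S → Cell D X} (hω : ∀ f, ω f ≠ none → f ∈ F) (ν : X → D) :
    (GMultitable.mk (inlineInv fun f : F => ω f) conds).apply ν = worldDB ω ν := by
  funext i
  ext t
  constructor
  · rintro ⟨s, ⟨d, _, hs⟩, rfl⟩
    exact ⟨d, s, hs, rfl⟩
  · rintro ⟨d, s, hs, rfl⟩
    exact ⟨s, ⟨d, fun a => hω _ (by simp [hs a]), hs⟩, rfl⟩

theorem mem_rep_iff {W : GWSD S D X} {A : Database S D} :
    A ∈ W.rep ↔ ∃ ω ν, Picks W ω ∧ (∀ l ∈ W.cond, l.Holds ν) ∧ A = worldDB ω ν := by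
  refine Set.mem_iUnion₂.trans ⟨?_, ?_⟩
  · rintro ⟨w, hw, ν, hν, rfl⟩
    classical
    obtain ⟨ω, hωw, hω⟩ : ∃ ω : Field S → Cell D X,
        (fun f : W.toGTST.schema => ω f) = w ∧ ∀ f, ω f ≠ none → f ∈ W.toGTST.schema :=
      ⟨fun f => if h : f ∈ W.toGTST.schema then w ⟨f, h⟩ else none,
        funext fun f => dif_pos f.2, fun f hf => by_contra fun h => hf (dif_neg h)⟩
    subst hωw
    exact ⟨ω, ν, ⟨hw, hω⟩, hν, apply_inlineInv_eq_worldDB _ hω ν⟩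
  · rintro ⟨ω, ν, ⟨hrow, hω⟩, hν, rfl⟩
    exact ⟨fun f => ω f, hrow, ν, hν, (apply_inlineInv_eq_worldDB _ hω ν).symm⟩

theorem SelCond.exists_alternatives_iff (p : SelCond D U) (τ : U → Term D X) (ν : X → D) :
    (∃ e ∈ p.alternatives τ, ∀ x ∈ e, x.1.eval ν = x.2.eval ν) ↔
      p.Holds fun A => (τ A).eval ν := by
  induction p with
  | top | eqAttr A B | eqConst A c => simp [alternatives, Holds, Term.eval]
  | and p q ihp ihq =>
    simp only [alternatives, Holds, ← ihp, ← ihq, List.mem_flatMap, List.mem_map]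
    constructor
    · rintro ⟨_, ⟨e, he, e', he', rfl⟩, h⟩
      rw [List.forall_mem_append] at h
      exact ⟨⟨e, he, h.1⟩, e', he', h.2⟩
    · rintro ⟨⟨e, he, h⟩, e', he', h'⟩
      exact ⟨_, ⟨e, he, e', he', rfl⟩, List.forall_mem_append.2 ⟨h, h'⟩⟩
  | or p q ihp ihq =>
    simp only [alternatives, Holds, ← ihp, ← ihq, List.mem_append, or_and_right, exists_or]

namespace SymbolicAnswer

variable {ω : Field S → Cell D X} {ν : X → D}

/-- The tuple `t` is the instance of the symbolic answer `s` in the world of `ω` and `ν`, which meet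
the requirements of `s`. -/
def Realizes (ω : Field S → Cell D X) (ν : X → D) (s : SymbolicAnswer S D X U) (t : Tuple D U) :
    Prop :=
  (∀ p ∈ s.entries, ω p.1 = some p.2) ∧ (∀ p ∈ s.eqs, p.1.eval ν = p.2.eval ν) ∧
    ∀ A, t A = (s.tuple A).eval ν

theorem exists_mem_select_realizes_iff {p : SelCond D U} {s : SymbolicAnswer S D X U}
    {t : Tuple D U} :
    (∃ s' ∈ s.select p, s'.Realizes ω ν t) ↔ s.Realizes ω ν t ∧ p.Holds t := by
  simp only [select, List.mem_map, exists_exists_and_eq_and, Realizes, List.forall_mem_append]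
  constructor
  · rintro ⟨e, he, hentries, ⟨halt, heqs⟩, ht⟩
    exact ⟨⟨hentries, heqs, ht⟩, funext ht ▸ (p.exists_alternatives_iff s.tuple ν).1 ⟨e, he, halt⟩⟩
  · rintro ⟨⟨hentries, heqs, ht⟩, hp⟩
    obtain ⟨e, he, halt⟩ := (p.exists_alternatives_iff s.tuple ν).2 (funext ht ▸ hp)
    exact ⟨e, he, hentries, ⟨halt, heqs⟩, ht⟩

theorem realizes_project_iff {h : V ⊆ U} {s : SymbolicAnswer S D X U} {t : Tuple D V} :
    (s.project h).Realizes ω ν t ↔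
      ∃ t' : Tuple D U, s.Realizes ω ν t' ∧ ∀ A, t A = t' ⟨A.1, h A.2⟩ := by
  constructor
  · rintro ⟨hentries, heqs, ht⟩
    exact ⟨_, ⟨hentries, heqs, fun _ => rfl⟩, ht⟩
  · rintro ⟨t', ⟨hentries, heqs, ht'⟩, ht⟩
    exact ⟨hentries, heqs, fun A => (ht A).trans (ht' _)⟩

theorem forall_unionTuple_iff {T : Type} (h : Disjoint U V) {τ : U → T} {τ' : V → T}
    {P : ↥(U ∪ V) → T → Prop} : (∀ A, P A (unionTuple τ τ' A)) ↔
      (∀ A : U, P ⟨A, Finset.mem_union_left _ A.2⟩ (τ A)) ∧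
        ∀ A : V, P ⟨A, Finset.mem_union_right _ A.2⟩ (τ' A) := by
  constructor
  · refine fun hP => ⟨fun A => ?_, fun A => ?_⟩
    · simpa [unionTuple] using hP ⟨A, Finset.mem_union_left _ A.2⟩
    · simpa [unionTuple, Finset.disjoint_right.1 h A.2] using
        hP ⟨A, Finset.mem_union_right _ A.2⟩
  · rintro ⟨hleft, hright⟩ ⟨A, hA⟩
    by_cases hAU : A ∈ U
    · simpa [unionTuple, hAU] using hleft ⟨A, hAU⟩
    · simpa [unionTuple, hAU] using hright ⟨A, (Finset.mem_union.1 hA).resolve_left hAU⟩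

theorem realizes_product_iff (h : Disjoint U V) {s : SymbolicAnswer S D X U}
    {s' : SymbolicAnswer S D X V} {t : Tuple D (U ∪ V)} : (s.product s').Realizes ω ν t ↔
      s.Realizes ω ν (fun A => t ⟨A.1, Finset.mem_union_left _ A.2⟩) ∧
        s'.Realizes ω ν (fun A => t ⟨A.1, Finset.mem_union_right _ A.2⟩) := by
  have htuple := forall_unionTuple_iff h (τ := s.tuple) (τ' := s'.tuple)
    (P := fun A (x : Term D X) => t A = x.eval ν)
  simp only [Realizes, product, List.forall_mem_append, htuple]
  tauto

theorem realizes_rename_iff {f : U ≃ V} {s : SymbolicAnswer S D X U} {t : Tuple D V} :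
    (s.rename f).Realizes ω ν t ↔ s.Realizes ω ν fun A => t (f A) := by
  simp only [Realizes, rename, f.surjective.forall, f.symm_apply_apply]

end SymbolicAnswer

open SymbolicAnswer

theorem PosQuery.mem_eval_iff {A : Database S D} {x₀ : Term D X} {cs : List (RawComponent S D X)}
    {ω : Field S → Cell D X} {ν : X → D}
    (hA : ∀ i t, t ∈ A i ↔ ∃ s ∈ relAnswers x₀ i cs, s.Realizes ω ν t)
    (q : PosQuery S D U) (t : Tuple D U) :
    t ∈ q.eval A ↔ ∃ s ∈ q.answers x₀ cs, s.Realizes ω ν t := by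
  induction q with
  | rel i => exact hA i t
  | select p q ih =>
    simp only [eval, answers, Set.mem_ofPred_eq, ih, List.mem_flatMap, ← exists_and_right,
      and_assoc, ← exists_mem_select_realizes_iff]
    grind
  | project V h q ih =>
    simp only [eval, answers, Set.mem_ofPred_eq, ih, List.mem_map, exists_exists_and_eq_and,
      realizes_project_iff]
    grind
  | product h q r ihq ihr =>
    simp only [eval, answers, Set.mem_ofPred_eq, ihq, ihr, List.mem_flatMap, List.mem_map]
    constructor
    · rintro ⟨⟨s, hs, hst⟩, s', hs', hst'⟩
      exact ⟨_, ⟨s, hs, s', hs', rfl⟩, (realizes_product_iff h).2 ⟨hst, hst'⟩⟩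
    · rintro ⟨_, ⟨s, hs, s', hs', rfl⟩, hst⟩
      obtain ⟨hst, hst'⟩ := (realizes_product_iff h).1 hst
      exact ⟨⟨s, hs, hst⟩, s', hs', hst'⟩
  | union q r ihq ihr =>
    simp only [eval, answers, Set.mem_union, ihq, ihr, List.mem_append, or_and_right, exists_or]
  | rename f q ih =>
    simp only [eval, answers, Set.mem_ofPred_eq, ih, List.mem_map, exists_exists_and_eq_and,
      realizes_rename_iff]

/-- A component as plain lists. -/
def Component.toRaw (C : Component S D X) : RawComponent S D X :=
  ⟨List.ofFn C.field, C.rows.map List.ofFn⟩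

theorem mem_zip_ofFn {α β : Type} {n : ℕ} {f : Fin n → α} {g : Fin n → β} {z : α × β} :
    z ∈ (List.ofFn f).zip (List.ofFn g) ↔ ∃ j, (f j, g j) = z := by
  have hzip : (List.ofFn f).zip (List.ofFn g) = List.ofFn fun j => (f j, g j) := by
    apply List.ext_getElem <;> simp
  rw [hzip, List.mem_ofFn]

theorem Component.entry?_toRaw (C : Component S D X) {r : Fin C.width → Cell D X}
    {j : Fin C.width} {x : Term D X} (hx : r j = some x) :
    C.toRaw.entry? (List.ofFn r) (C.field j) = some x := by
  have hmem (y : Term D X) : (y ∈ (C.toRaw.header.zip (List.ofFn r)).flatMap fun z =>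
      bif eqb z.1 (C.field j) then z.2.toList else []) ↔ y = x := by
    simp only [toRaw, List.mem_flatMap, mem_zip_ofFn, exists_exists_eq_and, Bool.cond_eq_ite,
      eqb_iff, C.field_injective.eq_iff]
    constructor
    · rintro ⟨k, hk⟩
      split at hk <;> simp_all
    · rintro rfl
      exact ⟨j, by simp [hx]⟩
  obtain ⟨y, l, hl⟩ := List.exists_cons_of_ne_nil (List.ne_nil_of_mem ((hmem x).2 rfl))
  rw [RawComponent.entry?, hl, List.head?_cons, (hmem y).1 (hl ▸ List.mem_cons_self)]

theorem mem_relAnswers {x₀ : Term D X} {i : Fin S.numRels} {cs : List (RawComponent S D X)}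
    {s : SymbolicAnswer S D X (S.attrs i)} : s ∈ relAnswers x₀ i cs ↔
      ∃ C ∈ cs, ∃ r ∈ C.rows, ∃ f ∈ C.header, f.rel = i ∧ s = C.symbolicTuple x₀ i r f.tid := by
  simp [relAnswers, Bool.cond_eq_ite]

theorem mem_worldDB_iff {W : GWSD S D X} {ω : Field S → Cell D X} (hω : Picks W ω) (ν : X → D)
    (x₀ : Term D X) (i : Fin S.numRels) (t : Tuple D (S.attrs i)) :
    t ∈ worldDB ω ν i ↔
      ∃ s ∈ relAnswers x₀ i (W.comps.map Component.toRaw), s.Realizes ω ν t := by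
  constructor
  · rintro ⟨d, s, hs, rfl⟩
    obtain ⟨a, ha⟩ := S.attrs_nonempty i
    obtain ⟨C, hC, hfield⟩ := hω.2 ⟨i, d, ⟨a, ha⟩⟩ (by simp [hs])
    obtain ⟨r, hr, hrω⟩ := hω.1 C hC
    have hentry (A : S.attrs i) : C.toRaw.entry? (List.ofFn r) ⟨i, d, A⟩ = some (s A) := by
      obtain ⟨j, hj⟩ := W.tupleLevel C hC i d ⟨a, ha⟩ A hfield
      rw [← hj]
      exact C.entry?_toRaw (by rw [← hrω, hj, hs])
    refine ⟨_, mem_relAnswers.2 ⟨C.toRaw, List.mem_map_of_mem hC, List.ofFn r,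
      List.mem_map_of_mem hr, ⟨i, d, ⟨a, ha⟩⟩, List.mem_ofFn.2 hfield, rfl, rfl⟩, ?_⟩
    simp only [Realizes, RawComponent.symbolicTuple, hentry, Option.getD_some]
    refine ⟨fun p hp => ?_, by simp, fun _ => trivial⟩
    obtain ⟨A, -, rfl⟩ := List.mem_map.1 hp
    exact hs A
  · rintro ⟨s, hs, hentries, -, ht⟩
    obtain ⟨C, -, r, -, f, -, -, rfl⟩ := mem_relAnswers.1 hs
    exact ⟨f.tid, _, fun A => hentries _ (List.mem_map.2 ⟨A, by simp, rfl⟩), funext ht⟩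

theorem compatible_iff {Cs : List (Component S D X)} {entries : List (Field S × Term D X)} :
    compatible (Cs.map Component.toRaw) entries = true ↔ ∀ C ∈ Cs, ∃ r ∈ C.rows,
      ∀ j, ∀ p ∈ entries, p.1 = C.field j → r j = some p.2 := by
  simp only [compatible, Component.toRaw, List.all_map, List.any_map, List.all_eq_true,
    List.any_eq_true, Function.comp_apply, mem_zip_ofFn, forall_exists_index,
    forall_apply_eq_imp_iff, Bool.or_eq_true, Bool.not_eq_true', eqb_false_iff, eqb_iff,
    ← imp_iff_not_or, eq_comm (a := some _)]

theorem covered_iff {Cs : List (Component S D X)} {entries : List (Field S × Term D X)} :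
    covered (Cs.map Component.toRaw) entries = true ↔
      ∀ p ∈ entries, ∃ C ∈ Cs, p.1 ∈ C.schema := by
  simp [covered, Component.toRaw, Component.schema]

theorem AttrGWSD.eq_of_mem_schema (W : AttrGWSD S D X) {C C' : Component S D X}
    (hC : C ∈ W.comps) (hC' : C' ∈ W.comps) {f : Field S} (hf : f ∈ C.schema)
    (hf' : f ∈ C'.schema) : C = C' := by
  by_contra hne
  have : Std.Symm fun C C' : Component S D X => Disjoint C.schema C'.schema :=
    ⟨fun _ _ h => h.symm⟩
  exact Set.disjoint_left.1 (W.disjoint.forall hC hC' hne) hf hf'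

theorem exists_picks_of_rows (W : GWSD S D X) (ρ : (C : Component S D X) → Fin C.width → Cell D X)
    (hρ : ∀ C ∈ W.comps, ρ C ∈ C.rows) :
    ∃ ω, Picks W ω ∧ ∀ C ∈ W.comps, ∀ j, ω (C.field j) = ρ C j := by
  have hentry (f : Field S) : ∃ x : Cell D X,
      (∀ C ∈ W.comps, ∀ j, C.field j = f → x = ρ C j) ∧
        (x ≠ none → ∃ C ∈ W.comps, f ∈ C.schema) := by
    by_cases hf : ∃ C ∈ W.comps, f ∈ C.schema
    · obtain ⟨C, hC, j, rfl⟩ := hf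
      refine ⟨ρ C j, fun C' hC' j' hj' => ?_, fun _ => ⟨C, hC, j, rfl⟩⟩
      obtain rfl := W.eq_of_mem_schema hC hC' ⟨j, rfl⟩ ⟨j', hj'⟩
      rw [C.field_injective hj']
    · exact ⟨none, fun C hC j hj => absurd ⟨C, hC, j, hj⟩ hf, fun h => absurd rfl h⟩
  choose ω hω hcovered using hentry
  exact ⟨ω, ⟨fun C hC => ⟨ρ C, hρ C hC, fun j => hω _ C hC j rfl⟩, hcovered⟩,
    fun C hC j => hω _ C hC j rfl⟩

theorem exists_picks_iff {W : GWSD S D X} {entries : List (Field S × Term D X)} :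
    (∃ ω, Picks W ω ∧ ∀ p ∈ entries, ω p.1 = some p.2) ↔
      covered (W.comps.map Component.toRaw) entries = true ∧
        compatible (W.comps.map Component.toRaw) entries = true := by
  rw [compatible_iff, covered_iff]
  constructor
  · rintro ⟨ω, ⟨hrow, hcovered⟩, hentries⟩
    refine ⟨fun p hp => hcovered _ (by simp [hentries p hp]), fun C hC => ?_⟩
    obtain ⟨r, hr, hrω⟩ := hrow C hC
    exact ⟨r, hr, fun j p hp hpj => by rw [← hrω, ← hpj, hentries p hp]⟩
  · rintro ⟨hcovered, hrow⟩
    choose! ρ hρ hentries using hrow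
    obtain ⟨ω, hω, hωρ⟩ := exists_picks_of_rows W ρ hρ
    refine ⟨ω, hω, fun p hp => ?_⟩
    obtain ⟨C, hC, j, hj⟩ := hcovered p hp
    rw [← hj, hωρ C hC]
    exact hentries C hC j p hp hj.symm

/-- A literal with its sign as a flag. -/
def Literal.toRaw : Literal D X → RawLiteral D X
  | .eq a b => (true, a, b)
  | .ne a b => (false, a, b)

theorem forall_holds_iff {ls : List (Literal D X)} {ν : X → D} : (∀ l ∈ ls, l.Holds ν) ↔
    Satisfies (Term.eval ν)
      (sidesOf true (ls.map Literal.toRaw), sidesOf false (ls.map Literal.toRaw)) := by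
  induction ls with
  | nil => simp [Satisfies, sidesOf]
  | cons l ls ih =>
    rw [List.forall_mem_cons, ih]
    cases l <;> simp [Satisfies, sidesOf, Literal.toRaw, Literal.Holds, eqb] <;> tauto

/-- A gWSD and a tuple as plain lists. -/
def toRawInput (p : GWSD S D X × Tuple D U) : RawInput S D X :=
  ⟨p.1.comps.map Component.toRaw, p.1.cond.map Literal.toRaw, tupleList fun A => .const (p.2 A)⟩

theorem forall_mem_zip_tupleList_iff {T T' : Type} {τ : U → T} {τ' : U → T'} {P : T × T' → Prop} :
    (∀ p ∈ (tupleList τ).zip (tupleList τ'), P p) ↔ ∀ A, P (τ A, τ' A) := by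
  simp only [tupleList, mem_zip_ofFn, forall_exists_index, forall_apply_eq_imp_iff,
    (U.orderIsoOfFin rfl).surjective.forall]

theorem decidePossible_iff [Infinite D] (x₀ : Term D X) (q : PosQuery S D U)
    (W : GWSD S D X) (t : Tuple D U) :
    decidePossible x₀ q (toRawInput (W, t)) = true ↔ TupleQPossible q W t := by
  simp only [decidePossible, toRawInput, List.any_eq_true, Bool.and_eq_true, ← exists_picks_iff,
    sat_iff, TupleQPossible, mem_rep_iff, forall_holds_iff, Satisfies, List.forall_mem_append,
    forall_mem_zip_tupleList_iff]
  constructor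
  · rintro ⟨s, hs, ⟨ω, hω, hentries⟩, ν, ⟨⟨hconds, heqs⟩, ht⟩, hneqs⟩
    refine ⟨_, ⟨ω, ν, hω, ⟨hconds, hneqs⟩, rfl⟩, ?_⟩
    rw [q.mem_eval_iff (mem_worldDB_iff hω ν x₀)]
    exact ⟨s, hs, hentries, heqs, fun A => (ht A).symm⟩
  · rintro ⟨_, ⟨ω, ν, hω, ⟨hconds, hneqs⟩, rfl⟩, ht⟩
    rw [q.mem_eval_iff (mem_worldDB_iff hω ν x₀)] at ht
    obtain ⟨s, hs, hentries, heqs, ht⟩ := ht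
    exact ⟨s, hs, ⟨ω, hω, hentries⟩, ν, ⟨⟨hconds, heqs⟩, fun A => (ht A).symm⟩, hneqs⟩

end Correctness

/-! ### Parsing the input word -/

section Symbols

/-- A numbering of the input alphabet. -/
def Sym.index : Sym → Fin 14
  | .bit false => 0
  | .bit true => 1
  | .const => 2
  | .var => 3
  | .bot => 4
  | .rel => 5
  | .tid => 6
  | .attr => 7
  | .comp => 8
  | .row => 9
  | .cond => 10
  | .eq => 11
  | .ne => 12
  | .tuple => 13

theorem Sym.index_injective : Function.Injective Sym.index := by
  intro a b h
  rcases a with ⟨_ | _⟩ | _ <;> rcases b with ⟨_ | _⟩ | _ <;>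
    first | rfl | exact absurd h (by decide)

noncomputable instance : Fintype Sym := Fintype.ofInjective _ Sym.index_injective

instance : Coded Sym := ⟨fun c => code c.index⟩

instance : CodeInjective Sym := ⟨fun _ _ h => Sym.index_injective (code_injective h)⟩

end Symbols

section Parser

/-- A value or a variable, given by the bits that encode it. -/
abbrev BitTerm : Type := Term (List Bool) (List Bool)

/-- The binary representations of the relation, the tuple identifier and the attribute. -/
abbrev BitField : Type := List Bool × List Bool × List Bool

/-- The header and the rows of a component. -/
abbrev BitComponent : Type := List BitField × List (List (Option BitTerm))

/-- The components, the literals and the values of the tuple; these are the parts of a `RawInput`,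
with bits in place of numbers, values and variables. -/
abbrev BitInput : Type :=
  List BitComponent × List (RawLiteral (List Bool) (List Bool)) × List BitTerm

/-- The state of the parser. As a marker precedes the part of the word that belongs to it, the
parser reads from right to left: it collects bits in the first entry of `field`, and moves
each of the unfinished parts `field`, `cells` and `component` to a larger one at its marker. -/
structure ParseState where
  field : BitField
  cells : List (Option BitTerm)
  component : BitComponent
  input : BitInput

/-- The first two terms of a list; the value `.const []` stands for missing terms. -/
def firstTerms (l : List BitTerm) : BitTerm × BitTerm :=
  (l.head?.getD (.const []), l.tail.head?.getD (.const []))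

/-- The parser reads one symbol. -/
def parseStep : Sym → ParseState → ParseState
  | .bit b, s => { s with field := (b :: s.field.1, s.field.2) }
  | .const, s => { s with
      field := ([], s.field.2)
      cells := some (.const s.field.1) :: s.cells }
  | .var, s => { s with
      field := ([], s.field.2)
      cells := some (.var s.field.1) :: s.cells }
  | .bot, s => { s with cells := none :: s.cells }
  | .attr, s => { s with field := ([], s.field.2.1, s.field.1) }
  | .tid, s => { s with field := ([], s.field.1, s.field.2.2) }
  | .rel, s => { s with
      field := ([], [], [])
      component := (s.field :: s.component.1, s.component.2) }
  | .row, s => { s with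
      cells := []
      component := (s.component.1, s.cells :: s.component.2) }
  | .comp, s => { s with
      component := ([], [])
      input := (s.component :: s.input.1, s.input.2) }
  | .eq, s => { s with
      cells := []
      input := (s.input.1, (true, firstTerms s.cells.reduceOption) :: s.input.2.1, s.input.2.2) }
  | .ne, s => { s with
      cells := []
      input := (s.input.1, (false, firstTerms s.cells.reduceOption) :: s.input.2.1, s.input.2.2) }
  | .cond, s => s
  | .tuple, s => { s with
      cells := []
      input := (s.input.1, s.input.2.1, s.cells.reduceOption) }

/-- The state of the parser between two fields or terms. -/
def ParseState.idle (cells : List (Option BitTerm)) (component : BitComponent) (input : BitInput) :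
    ParseState :=
  ⟨([], [], []), cells, component, input⟩

/-- The input given by a reversed word. -/
def parse (w : List Sym) : BitInput :=
  (w.foldl (fun s c => parseStep c s) (.idle [] ([], []) ([], [], []))).input

end Parser

section ParserPolyTime

variable {α : Type} [Coded α]

instance : Coded ParseState := ⟨fun s => code (s.field, s.cells, s.component, s.input)⟩

theorem csize_parseState (s : ParseState) :
    csize s = csize s.field + csize s.cells + csize s.component + csize s.input + 3 := by
  rw [show csize s = csize (s.field, s.cells, s.component, s.input) from rfl]
  simp only [csize_prod]
  ring

theorem polyTime_parseState_parts {f : α → ParseState} (hf : PolyTime f) :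
    PolyTime (fun a => ((f a).field, (f a).cells, (f a).component, (f a).input)) :=
  hf.of_code (fun a => a) (fun _ => rfl) fun _ => rfl

@[fun_prop]
theorem polyTime_field {f : α → ParseState} (hf : PolyTime f) : PolyTime (fun a => (f a).field) :=
  (polyTime_parseState_parts hf).fst_comp

@[fun_prop]
theorem polyTime_cells {f : α → ParseState} (hf : PolyTime f) : PolyTime (fun a => (f a).cells) :=
  (polyTime_parseState_parts hf).snd_comp.fst_comp

@[fun_prop]
theorem polyTime_component {f : α → ParseState} (hf : PolyTime f) :
    PolyTime (fun a => (f a).component) :=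
  (polyTime_parseState_parts hf).snd_comp.snd_comp.fst_comp

@[fun_prop]
theorem polyTime_input {f : α → ParseState} (hf : PolyTime f) : PolyTime (fun a => (f a).input) :=
  (polyTime_parseState_parts hf).snd_comp.snd_comp.snd_comp

@[fun_prop]
theorem polyTime_parseState_mk {f : α → BitField} {g : α → List (Option BitTerm)}
    {h : α → BitComponent} {k : α → BitInput} (hf : PolyTime f) (hg : PolyTime g)
    (hh : PolyTime h) (hk : PolyTime k) :
    PolyTime (fun a => (⟨f a, g a, h a, k a⟩ : ParseState)) :=
  (hf.prodMk (hg.prodMk (hh.prodMk hk))).of_code (fun a => a) (fun _ => rfl) fun _ => rfl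

@[fun_prop]
theorem polyTime_term_const {f : α → List Bool} (hf : PolyTime f) :
    PolyTime (fun a => (.const (f a) : BitTerm)) :=
  ((PolyTime.const true).prodMk hf).of_code (fun a => a) (fun _ => rfl) fun _ => rfl

@[fun_prop]
theorem polyTime_term_var {f : α → List Bool} (hf : PolyTime f) :
    PolyTime (fun a => (.var (f a) : BitTerm)) :=
  ((PolyTime.const false).prodMk hf).of_code (fun a => a) (fun _ => rfl) fun _ => rfl

@[fun_prop]
theorem polyTime_firstTerms {f : α → List BitTerm} (hf : PolyTime f) :
    PolyTime (fun a => firstTerms (f a)) := by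
  unfold firstTerms
  fun_prop

@[fun_prop]
theorem polyTime_reduceOption {f : α → List (Option BitTerm)} (hf : PolyTime f) :
    PolyTime (fun a => (f a).reduceOption) :=
  PolyTime.congr (g := fun a => (f a).flatMap Option.toList) (by fun_prop) fun a =>
    List.filterMap_eq_flatMap_toList id (f a)

theorem polyTime_parseStep (c : Sym) : PolyTime (parseStep c) := by
  rcases c with b | _ <;> unfold parseStep <;> fun_prop

@[simp]
theorem csize_none : csize (none : Option α) = 1 := rfl

@[simp]
theorem csize_some (a : α) : csize (some a) = csize a + 2 := csize_cons a []

@[simp]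
theorem csize_term_const (l : List Bool) : csize (.const l : BitTerm) = csize l + 4 :=
  (csize_prod true l).trans (by rw [show csize true = 3 from rfl]; ring)

@[simp]
theorem csize_term_var (l : List Bool) : csize (.var l : BitTerm) = csize l + 2 :=
  (csize_prod false l).trans (by rw [show csize false = 1 from rfl]; ring)

theorem csize_firstTerms_le (l : List BitTerm) : csize (firstTerms l) ≤ csize l + 12 := by
  rcases l with _ | ⟨a, _ | ⟨b, l⟩⟩
  · exact (by decide : 11 ≤ 1 + 12)
  · simp [firstTerms]
  · simp [firstTerms]
    omega

theorem csize_reduceOption_le (l : List (Option BitTerm)) : csize l.reduceOption ≤ csize l := by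
  induction l with
  | nil => rfl
  | cons a l ih =>
    cases a with
    | none => simpa using by omega
    | some a => simpa using by omega

theorem csize_parseStep_le (c : Sym) (s : ParseState) : csize (parseStep c s) ≤ csize s + 20 := by
  have hterms := csize_firstTerms_le s.cells.reduceOption
  have hreduce := csize_reduceOption_le s.cells
  have hbool := csize_bool_le
  obtain ⟨⟨number, tid, attr⟩, cells, ⟨header, rows⟩, comps, lits, values⟩ := s
  rcases c with b | _ <;> simp only [parseStep, csize_parseState, csize_prod, csize_cons,
    csize_nil, csize_none, csize_some, csize_term_const, csize_term_var] at * <;> grind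

theorem polyTime_parse : PolyTime parse := by
  have hstep : PolyTime (fun p : List Sym × ParseState × Sym => parseStep p.2.2 p.2.1) :=
    PolyTime.finite_cases (c := fun p : List Sym × ParseState × Sym => p.2.2)
      (g := fun c p => parseStep c p.2.1) (by fun_prop)
      fun c => (polyTime_parseStep c).comp (by fun_prop)
  exact polyTime_input (.foldl (h := fun _ s c => parseStep c s) .id (.const _) hstep 20
    fun a s c _ => (csize_parseStep_le c s).trans (by simp))

end ParserPolyTime

section ParserCorrectness

variable {S : RelSchema} {D X : Type} {U : Finset ℕ} (encD : D → List Bool) (encX : X → List Bool)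

/-- The bits that encode a value or a variable. -/
def Term.toBits : Term D X → BitTerm
  | .const c => .const (encD c)
  | .var x => .var (encX x)

/-- The binary representation of a field. -/
def Field.toBits (f : Field S) : BitField :=
  (Computability.encodeNat f.rel, Computability.encodeNat f.tid, Computability.encodeNat f.attr)

/-- The binary representation of a component. -/
def RawComponent.toBits (C : RawComponent S D X) : BitComponent :=
  (C.header.map Field.toBits, C.rows.map fun r => r.map (Option.map (Term.toBits encD encX)))

/-- The binary representation of a literal. -/
def RawLiteral.toBits (l : RawLiteral D X) : RawLiteral (List Bool) (List Bool) :=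
  (l.1, l.2.1.toBits encD encX, l.2.2.toBits encD encX)

/-- The binary representation of an input. -/
def RawInput.toBits (x : RawInput S D X) : BitInput :=
  (x.comps.map (RawComponent.toBits encD encX), x.lits.map (RawLiteral.toBits encD encX),
    x.values.map (Term.toBits encD encX))

/-- The state of the parser after reading the word `w` from right to left. -/
abbrev parseFrom (w : List Sym) (s : ParseState) : ParseState := w.foldr parseStep s

open IncompleteDB.ParseState (idle)

theorem parseFrom_append (w w' : List Sym) (s : ParseState) :
    parseFrom (w ++ w') s = parseFrom w (parseFrom w' s) :=
  List.foldr_append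

theorem parseFrom_cons (c : Sym) (w : List Sym) (s : ParseState) :
    parseFrom (c :: w) s = parseStep c (parseFrom w s) :=
  rfl

theorem parseFrom_encodeBits (l : List Bool) (s : ParseState) :
    parseFrom (encodeBits l) s = { s with field := (l ++ s.field.1, s.field.2) } := by
  induction l with
  | nil => rfl
  | cons b l ih => rw [encodeBits, List.map_cons, parseFrom_cons, ← encodeBits, ih]; rfl

variable {cells : List (Option BitTerm)} {component : BitComponent} {input : BitInput}

theorem parseFrom_encodeField (f : Field S) :
    parseFrom (encodeField f) (idle cells component input) =
      idle cells (f.toBits :: component.1, component.2) input := by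
  simp only [encodeField, encodeNum, List.cons_append, List.append_assoc, parseFrom_cons,
    parseFrom_append, parseFrom_encodeBits, parseStep, idle, List.append_nil, Field.toBits]

theorem parseFrom_encodeFields (l : List (Field S)) :
    parseFrom (l.flatMap encodeField) (idle cells component input) =
      idle cells (l.map Field.toBits ++ component.1, component.2) input := by
  induction l with
  | nil => rfl
  | cons f l ih => rw [List.flatMap_cons, parseFrom_append, ih, parseFrom_encodeField]; rfl

variable {encD encX}

theorem parseFrom_encodeTerm (a : Term D X) :
    parseFrom (encodeTerm encD encX a) (idle cells component input) =
      idle (some (a.toBits encD encX) :: cells) component input := by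
  cases a <;> simp only [encodeTerm, parseFrom_cons, parseFrom_encodeBits, parseStep, idle,
    List.append_nil, Term.toBits]

theorem parseFrom_encodeCell (c : Cell D X) :
    parseFrom (encodeCell encD encX c) (idle cells component input) =
      idle (c.map (Term.toBits encD encX) :: cells) component input := by
  cases c with
  | none => rfl
  | some a => exact parseFrom_encodeTerm a

theorem parseFrom_encodeCells (l : List (Cell D X)) :
    parseFrom (l.flatMap (encodeCell encD encX)) (idle cells component input) =
      idle (l.map (Option.map (Term.toBits encD encX)) ++ cells) component input := by
  induction l with
  | nil => rfl
  | cons c l ih => rw [List.flatMap_cons, parseFrom_append, ih, parseFrom_encodeCell]; rfl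

theorem parseFrom_encodeRows (l : List (List (Cell D X))) :
    parseFrom (l.flatMap fun r => Sym.row :: r.flatMap (encodeCell encD encX))
        (idle [] component input) =
      idle [] (component.1,
        (l.map fun r => r.map (Option.map (Term.toBits encD encX))) ++ component.2) input := by
  induction l with
  | nil => rfl
  | cons r l ih =>
    rw [List.flatMap_cons, parseFrom_append, ih, parseFrom_cons, parseFrom_encodeCells,
      List.append_nil]
    rfl

theorem parseFrom_encodeComponent (C : Component S D X) :
    parseFrom (encodeComponent encD encX C) (idle [] ([], []) input) =
      idle [] ([], []) (C.toRaw.toBits encD encX :: input.1, input.2) := by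
  have hword : encodeComponent encD encX C = Sym.comp :: (C.toRaw.header.flatMap encodeField ++
      C.toRaw.rows.flatMap fun r => Sym.row :: r.flatMap (encodeCell encD encX)) := by
    simp [encodeComponent, Component.toRaw, List.flatMap_def, List.map_ofFn, Function.comp_def]
  rw [hword, parseFrom_cons, parseFrom_append, parseFrom_encodeRows, parseFrom_encodeFields,
    List.append_nil, List.append_nil]
  rfl

theorem parseFrom_encodeComponents (l : List (Component S D X)) :
    parseFrom (l.flatMap (encodeComponent encD encX)) (idle [] ([], []) input) =
      idle [] ([], []) ((l.map fun C => C.toRaw.toBits encD encX) ++ input.1, input.2) := by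
  induction l with
  | nil => rfl
  | cons C l ih => rw [List.flatMap_cons, parseFrom_append, ih, parseFrom_encodeComponent]; rfl

theorem parseFrom_encodeLiteral (l : Literal D X) :
    parseFrom (encodeLiteral encD encX l) (idle [] component input) =
      idle [] component (input.1, l.toRaw.toBits encD encX :: input.2.1, input.2.2) := by
  cases l <;> simp only [encodeLiteral, parseFrom_cons, parseFrom_append, parseFrom_encodeTerm] <;>
    rfl

theorem parseFrom_encodeLiterals (l : List (Literal D X)) :
    parseFrom (l.flatMap (encodeLiteral encD encX)) (idle [] component input) =
      idle [] component
        (input.1, (l.map fun a => a.toRaw.toBits encD encX) ++ input.2.1, input.2.2) := by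
  induction l with
  | nil => rfl
  | cons a l ih => rw [List.flatMap_cons, parseFrom_append, ih, parseFrom_encodeLiteral]; rfl

theorem parseFrom_encodeTuple (t : Tuple D U) :
    parseFrom (encodeTuple encD t) (idle [] component input) =
      idle [] component (input.1, input.2.1, (tupleList t).map fun d => .const (encD d)) := by
  have hword : encodeTuple encD t = Sym.tuple :: (((tupleList t).map fun d =>
      (some (.const d) : Cell D Empty)).flatMap (encodeCell encD nofun)) := by
    simp [encodeTuple, tupleList, List.flatMap_def, List.map_ofFn, Function.comp_def, encodeCell,
      encodeTerm]
  rw [hword, parseFrom_cons, parseFrom_encodeCells, List.append_nil]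
  simp [parseStep, idle, List.reduceOption, List.filterMap_map, Function.comp_def, Term.toBits]

theorem parse_encodeInput (p : GWSD S D X × Tuple D U) :
    parse (encodeInput encD encX p).reverse = (toRawInput p).toBits encD encX := by
  have hfold : (encodeInput encD encX p).reverse.foldl (fun s c => parseStep c s)
      (idle [] ([], []) ([], [], [])) =
        parseFrom (encodeInput encD encX p) (idle [] ([], []) ([], [], [])) :=
    List.foldl_reverse
  rw [parse, hfold, encodeInput, parseFrom_append, parseFrom_encodeTuple, encodeGWSD,
    parseFrom_append, parseFrom_cons, parseFrom_encodeLiterals, parseStep,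
    parseFrom_encodeComponents]
  simp [toRawInput, RawInput.toBits, idle, tupleList, Term.toBits, Function.comp_def, List.map_ofFn]

end ParserCorrectness

theorem code_map {β γ : Type} [Coded β] [Coded γ] {g : β → γ} (hg : ∀ b, code (g b) = code b)
    (l : List β) : code (l.map g) = code l := by
  induction l with
  | nil => rfl
  | cons b l ih => rw [List.map_cons, code_cons, code_cons, hg, ih]

theorem code_pair_congr {β β' γ γ' : Type} [Coded β] [Coded β'] [Coded γ] [Coded γ']
    {b : β} {b' : β'} {c : γ} {c' : γ'} (hb : code b = code b') (hc : code c = code c') :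
    code (b, c) = code (b', c') :=
  congrArg₂ (BinaryTree.node ()) hb hc

section ToBits

variable {S : RelSchema} {D X : Type} [Coded D] [Coded X]
  {encD : D → List Bool} {encX : X → List Bool}

theorem Term.code_toBits (hD : ∀ d, code (encD d) = code d) (hX : ∀ x, code (encX x) = code x)
    (a : Term D X) : code (a.toBits encD encX) = code a := by
  cases a with
  | const c => exact code_pair_congr rfl (hD c)
  | var x => exact code_pair_congr rfl (hX x)

theorem Cell.code_toBits (hD : ∀ d, code (encD d) = code d) (hX : ∀ x, code (encX x) = code x)
    (c : Cell D X) : code (c.map (Term.toBits encD encX)) = code c := by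
  cases c with
  | none => rfl
  | some a => exact code_map (Term.code_toBits hD hX) [a]

theorem RawComponent.code_toBits (hD : ∀ d, code (encD d) = code d)
    (hX : ∀ x, code (encX x) = code x) (C : RawComponent S D X) :
    code (C.toBits encD encX) = code C :=
  code_pair_congr (code_map (g := Field.toBits) (fun _ => rfl) _)
    (code_map (code_map (Cell.code_toBits hD hX)) _)

theorem RawLiteral.code_toBits (hD : ∀ d, code (encD d) = code d)
    (hX : ∀ x, code (encX x) = code x) (l : RawLiteral D X) :
    code (l.toBits encD encX) = code l :=
  code_pair_congr rfl
    (code_pair_congr (Term.code_toBits hD hX _) (Term.code_toBits hD hX _))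

theorem RawInput.code_toBits (hD : ∀ d, code (encD d) = code d)
    (hX : ∀ x, code (encX x) = code x) (I : RawInput S D X) :
    code (I.toBits encD encX) = code I :=
  code_pair_congr (code_map (RawComponent.code_toBits hD hX) _)
    (code_pair_congr (code_map (RawLiteral.code_toBits hD hX) _)
      (code_map (Term.code_toBits hD hX) _))

end ToBits

theorem tupleQPossible_inPTIME {D X : Type} [Infinite D] {encD : D → List Bool}
    (hencD : Function.Injective encD) {encX : X → List Bool} (hencX : Function.Injective encX)
    {S : RelSchema} {U : Finset ℕ} (q : PosQuery S D U) :
    InPTIME (encodeInput encD encX)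
      (fun p : GWSD S D X × Tuple D U => TupleQPossible q p.1 p.2) := by
  let : Coded D := ⟨fun d => code (encD d)⟩
  let : Coded X := ⟨fun x => code (encX x)⟩
  let : Coded (GWSD S D X × Tuple D U) := ⟨fun p => code (encodeInput encD encX p).reverse⟩
  have : CodeInjective D := ⟨fun _ _ h => hencD (code_injective h)⟩
  have : CodeInjective X := ⟨fun _ _ h => hencX (code_injective h)⟩
  have hraw : PolyTime (toRawInput : GWSD S D X × Tuple D U → RawInput S D X) :=
    polyTime_parse.of_code (fun p => (encodeInput encD encX p).reverse) (fun _ => rfl) fun p => by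
      rw [parse_encodeInput]
      exact (RawInput.code_toBits (encD := encD) (encX := encX)
        (fun _ => rfl) (fun _ => rfl) _).symm
  obtain ⟨d₀⟩ : Nonempty D := inferInstance
  exact ((polyTime_decidePossible (.const d₀) q).comp hraw).inPTIME (fun _ => rfl)
    fun p => decidePossible_iff (.const d₀) q p.1 p.2

end IncompleteDB

theorem mainTheorem6 {D X : Type} [Infinite D]
    (encD : D → List Bool) (hencD : Function.Injective encD)
    (encX : X → List Bool) (hencX : Function.Injective encX)
    (S : RelSchema) :
    (∀ (U : Finset ℕ) (q : PosQuery S D U),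
      InPTIME (encodeInput encD encX)
        (fun p : GWSD S D X × Tuple D U => TupleQPossible q p.1 p.2)) ∧
    (∀ i : Fin S.numRels,
      InPTIME (encodeInput encD encX)
        (fun p : GWSD S D X × Tuple D (S.attrs i) => TuplePossible i p.1 p.2)) :=
  ⟨fun _ q => tupleQPossible_inPTIME hencD hencX q,
    fun i => tupleQPossible_inPTIME hencD hencX (.rel i)⟩
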